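/- Let $k$ be a commutative ring with unit, let $A$ and $B$ be unital associative $k$-algebras, let $M$ be an $(A,B)$-bimodule on which $k$ acts centrally, and let $E=\begin{pmatrix}A&M\\0&B\end{pmatrix}$ be the triangular matrix algebra. Let $X$ be an $E$-bimodule on which $k$ acts centrally. Write $1_A=\begin{pmatrix}1&0\\0&0\end{pmatrix}$, $1_B=\begin{pmatrix}0&0\\0&1\end{pmatrix}$, $X_{AA}=1_AX1_A$, $X_{BB}=1_BX1_B$, $X_{BA}=1_BX1_A$; these are an $A$-bimodule, a $B$-bimodule and a $(B,A)$-bimodule, respectively. For a $k$-algebra $C$ and a $C$-bimodule $Y$ let $\operatorname{H}_n(C,Y)$ denote Hochschild homology, that is, the homology of the complex $(Y\otimes C^{\otimes n})_{n\ge 0}$ with the Hochschild boundary $$b(y\otimes c_1\otimes\cdots\otimes c_n)=yc_1\otimes c_2\otimes\cdots\otimes c_n+\sum_{i=1}^{n-1}(-1)^i\,y\otimes c_1\otimes\cdots\otimes c_ic_{i+1}\otimes\cdots\otimes c_n+(-1)^n c_ny\otimes c_1\otimes\cdots\otimes c_{n-1},$$ where $\otimes=\otimes_k$. Regard $M$ as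 a left $A\otimes B^{\operatorname{op}}$-module and $X_{BA}$ as a right $A\otimes B^{\operatorname{op}}$-module, by $(a\otimes b)m=amb$ and $x(a\otimes b)=bxa$, and let $\operatorname{Tor}_n^{A\otimes B^{\operatorname{op}},k}(M,X_{BA})$ denote the Tor groups of $M$ relative to the family of the $A\otimes B^{\operatorname{op}}$-linear epimorphisms which split as $k$-linear maps: $\operatorname{Tor}_n^{A\otimes B^{\operatorname{op}},k}(M,X_{BA})=H_n(X_{BA}\otimes_{A\otimes B^{\operatorname{op}}}P_*)$, where $P_*\to M$ is any resolution by $A\otimes B^{\operatorname{op}}$-modules that have the lifting property with respect to this family, such that the augmented complex is contractible as a complex of $k$-modules. Then there exists a long exact sequence of $k$-modules $$\begin{aligned} \cdots&\to\operatorname{Tor}_{n}^{A\otimes B^{\operatorname{op}},k}(M,X_{BA})\to \operatorname{H}_n(A,X_{AA})\oplus \operatorname{H}_n(B,X_{BB})\to \operatorname{H}_n(E,X)\to\operatorname{Tor}_{n-1}^{A\otimes B^{\operatorname{op}},k}(M,X_{BA})\to\cdots\\ \cdots&\to\operatorname{Tor}_1^{A\otimes B^{\operatorname{op}},k}(M,X_{BA})\to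 \operatorname{H}_1(A,X_{AA})\oplus \operatorname{H}_1(B,X_{BB})\to \operatorname{H}_1(E,X)\\ &\to\operatorname{Tor}_0^{A\otimes B^{\operatorname{op}},k}(M,X_{BA})\to \operatorname{H}_0(A,X_{AA})\oplus \operatorname{H}_0(B,X_{BB})\to \operatorname{H}_0(E,X)\to 0. \end{aligned}$$ -/

import Mathlib

universe u

noncomputable section

open scoped TensorProduct
open MulOpposite

set_option linter.unusedSectionVars false

/-! ### The triangular matrix algebra -/

/-- The triangular matrices with diagonal entries `a : A`, `b : B` and upper right entry `m : M`. -/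
@[ext]
structure TriangularAlgebra (A M B : Type u) : Type u where
  a : A
  m : M
  b : B

namespace TriangularAlgebra

variable {k A M B : Type u} [CommRing k] [Ring A] [Algebra k A] [Ring B] [Algebra k B]
  [AddCommGroup M] [Module k M] [Module A M] [Module Bᵐᵒᵖ M] [SMulCommClass A Bᵐᵒᵖ M]
  [IsScalarTower k A M] [IsScalarTower k Bᵐᵒᵖ M]

/-- A triangular matrix is the same as the triple of its entries. -/
def equivProd (A M B : Type u) : TriangularAlgebra A M B ≃ A × M × B where
  toFun x := (x.a, x.m, x.b)
  invFun x := ⟨x.1, x.2.1, x.2.2⟩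
  left_inv _ := rfl
  right_inv _ := rfl

/-- Addition is entrywise. -/
instance : AddCommGroup (TriangularAlgebra A M B) := (equivProd A M B).addCommGroup

/-- Scalars act entrywise. -/
instance : Module k (TriangularAlgebra A M B) := (equivProd A M B).module k

/-- The product of triangular matrices; `op b • m` is the right action `m b`. -/
instance : Mul (TriangularAlgebra A M B) :=
  ⟨fun x y => ⟨x.a * y.a, x.a • y.m + op y.b • x.m, x.b * y.b⟩⟩

instance : One (TriangularAlgebra A M B) := ⟨⟨1, 0, 1⟩⟩

@[simp] theorem zero_a : (0 : TriangularAlgebra A M B).a = 0 := rfl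
@[simp] theorem zero_m : (0 : TriangularAlgebra A M B).m = 0 := rfl
@[simp] theorem zero_b : (0 : TriangularAlgebra A M B).b = 0 := rfl
@[simp] theorem one_a : (1 : TriangularAlgebra A M B).a = 1 := rfl
@[simp] theorem one_m : (1 : TriangularAlgebra A M B).m = 0 := rfl
@[simp] theorem one_b : (1 : TriangularAlgebra A M B).b = 1 := rfl
@[simp] theorem add_a (x y : TriangularAlgebra A M B) : (x + y).a = x.a + y.a := rfl
@[simp] theorem add_m (x y : TriangularAlgebra A M B) : (x + y).m = x.m + y.m := rfl
@[simp] theorem add_b (x y : TriangularAlgebra A M B) : (x + y).b = x.b + y.b := rfl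
@[simp] theorem smul_a (c : k) (x : TriangularAlgebra A M B) : (c • x).a = c • x.a := rfl
@[simp] theorem smul_m (c : k) (x : TriangularAlgebra A M B) : (c • x).m = c • x.m := rfl
@[simp] theorem smul_b (c : k) (x : TriangularAlgebra A M B) : (c • x).b = c • x.b := rfl
@[simp] theorem mul_a (x y : TriangularAlgebra A M B) : (x * y).a = x.a * y.a := rfl
@[simp] theorem mul_m (x y : TriangularAlgebra A M B) :
    (x * y).m = x.a • y.m + op y.b • x.m := rfl
@[simp] theorem mul_b (x y : TriangularAlgebra A M B) : (x * y).b = x.b * y.b := rfl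

instance : Ring (TriangularAlgebra A M B) where
  __ := (inferInstance : AddCommGroup (TriangularAlgebra A M B))
  mul := (· * ·)
  one := 1
  left_distrib x y z := by ext <;> simp [mul_add, add_smul]; abel
  right_distrib x y z := by ext <;> simp [add_mul, add_smul]; abel
  zero_mul x := by ext <;> simp
  mul_zero x := by ext <;> simp
  mul_assoc x y z := by
    ext <;> simp [mul_assoc, mul_smul, add_assoc, smul_comm x.a (op z.b) y.m]
  one_mul x := by ext <;> simp
  mul_one x := by ext <;> simp

instance : Algebra k (TriangularAlgebra A M B) :=
  Algebra.ofModule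
    (fun c x y => by
      ext <;> simp [smul_add, smul_comm c (op y.b) x.m])
    (fun c x y => by
      ext <;> simp [smul_add, smul_comm c x.a y.m])

variable (k A M B)

/-- The inclusion of `A` as the upper left corner; it sends `1` to the idempotent `1_A`. -/
def inclA : A →ₙₐ[k] TriangularAlgebra A M B where
  toFun a := ⟨a, 0, 0⟩
  map_smul' c x := by ext <;> simp
  map_zero' := rfl
  map_add' x y := by ext <;> simp
  map_mul' x y := by ext <;> simp

/-- The inclusion of `B` as the lower right corner; it sends `1` to the idempotent `1_B`. -/
def inclB : B →ₙₐ[k] TriangularAlgebra A M B where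
  toFun b := ⟨0, 0, b⟩
  map_smul' c x := by ext <;> simp
  map_zero' := rfl
  map_add' x y := by ext <;> simp
  map_mul' x y := by ext <;> simp

end TriangularAlgebra

/-! ### Corners of a bimodule -/

section Corner

variable {k S X C D : Type u} [CommRing k] [Ring S] [Algebra k S]
  [AddCommGroup X] [Module k X] [Module S X] [Module Sᵐᵒᵖ X] [SMulCommClass S Sᵐᵒᵖ X]
  [IsScalarTower k S X] [IsScalarTower k Sᵐᵒᵖ X]
  [Ring C] [Algebra k C] [Ring D] [Algebra k D]

variable (X) in
/-- For an `S`-bimodule `X` and multiplicative inclusions `φ : C → S`, `ψ : D → S`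
(not necessarily unital), the corner `φ(1) X ψ(1)`. -/
def cornerSubmodule (φ : C →ₙₐ[k] S) (ψ : D →ₙₐ[k] S) : Submodule k X :=
  LinearMap.range
    (Algebra.lsmul k k X (φ 1) ∘ₗ Algebra.lsmul k k X (op (ψ 1)))

variable (X) in
/-- The corner `φ(1) X ψ(1)`, as a type. It is a `(C, D)`-bimodule by
`c x d = φ(c) x ψ(d)`. -/
def Corner (φ : C →ₙₐ[k] S) (ψ : D →ₙₐ[k] S) : Type u := cornerSubmodule X φ ψ

namespace Corner

variable (φ : C →ₙₐ[k] S) (ψ : D →ₙₐ[k] S)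

instance : AddCommGroup (Corner X φ ψ) := inferInstanceAs (AddCommGroup (cornerSubmodule X φ ψ))

instance : Module k (Corner X φ ψ) := inferInstanceAs (Module k (cornerSubmodule X φ ψ))

variable (X) in
/-- The inclusion of the corner in `X`. -/
def val : Corner X φ ψ →ₗ[k] X := (cornerSubmodule X φ ψ).subtype

variable {φ ψ}

theorem val_injective : Function.Injective (val X φ ψ) := Subtype.val_injective

theorem left_one (x : Corner X φ ψ) : φ 1 • val X φ ψ x = val X φ ψ x := by
  obtain ⟨_, y, rfl⟩ := x
  change φ 1 • φ 1 • op (ψ 1) • y = φ 1 • op (ψ 1) • y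
  rw [← mul_smul, ← map_mul, one_mul]

theorem right_one (x : Corner X φ ψ) : op (ψ 1) • val X φ ψ x = val X φ ψ x := by
  obtain ⟨_, y, rfl⟩ := x
  change op (ψ 1) • φ 1 • op (ψ 1) • y = φ 1 • op (ψ 1) • y
  rw [← smul_comm (φ 1), ← mul_smul (op (ψ 1)), ← op_mul, ← map_mul, one_mul]

instance : SMul C (Corner X φ ψ) :=
  ⟨fun c x => ⟨φ c • val X φ ψ x, φ c • val X φ ψ x, by
    change φ 1 • op (ψ 1) • φ c • val X φ ψ x = _
    rw [← smul_comm (φ c), right_one, ← mul_smul, ← map_mul, one_mul]⟩⟩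

instance : SMul Dᵐᵒᵖ (Corner X φ ψ) :=
  ⟨fun d x => ⟨op (ψ d.unop) • val X φ ψ x, op (ψ d.unop) • val X φ ψ x, by
    change φ 1 • op (ψ 1) • op (ψ d.unop) • val X φ ψ x = _
    rw [← mul_smul (op (ψ 1)), ← op_mul, ← map_mul, mul_one, smul_comm (φ 1), left_one]⟩⟩

theorem val_smul_left (c : C) (x : Corner X φ ψ) : val X φ ψ (c • x) = φ c • val X φ ψ x := rfl

theorem val_smul_right (d : Dᵐᵒᵖ) (x : Corner X φ ψ) :
    val X φ ψ (d • x) = op (ψ d.unop) • val X φ ψ x := rfl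

instance : Module C (Corner X φ ψ) where
  one_smul x := val_injective (by rw [val_smul_left, left_one])
  mul_smul c c' x := val_injective (by simp only [val_smul_left, map_mul, mul_smul])
  smul_zero c := val_injective (by simp only [val_smul_left, map_zero, smul_zero])
  smul_add c x y := val_injective (by simp only [val_smul_left, map_add, smul_add])
  add_smul c c' x := val_injective (by simp only [val_smul_left, map_add, add_smul])
  zero_smul x := val_injective (by simp only [val_smul_left, map_zero, zero_smul])

instance : Module Dᵐᵒᵖ (Corner X φ ψ) where
  one_smul x := val_injective (by rw [val_smul_right, unop_one, right_one])
  mul_smul c c' x := val_injective (by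
    simp only [val_smul_right, unop_mul, map_mul, op_mul, mul_smul])
  smul_zero c := val_injective (by simp only [val_smul_right, map_zero, smul_zero])
  smul_add c x y := val_injective (by simp only [val_smul_right, map_add, smul_add])
  add_smul c c' x := val_injective (by
    simp only [val_smul_right, map_add, MulOpposite.unop_add, MulOpposite.op_add, add_smul])
  zero_smul x := val_injective (by
    simp only [val_smul_right, map_zero, MulOpposite.unop_zero, MulOpposite.op_zero, zero_smul])

instance : SMulCommClass C Dᵐᵒᵖ (Corner X φ ψ) :=
  ⟨fun c d x => val_injective (by
    simp only [val_smul_left, val_smul_right]; exact smul_comm _ _ _)⟩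

instance : IsScalarTower k C (Corner X φ ψ) :=
  ⟨fun r c x => val_injective (by simp only [val_smul_left, map_smul, smul_assoc])⟩

instance : IsScalarTower k Dᵐᵒᵖ (Corner X φ ψ) :=
  ⟨fun r d x => val_injective (by
    simp only [val_smul_right, map_smul, unop_smul, op_smul, smul_assoc])⟩

end Corner

end Corner

namespace TriangularAlgebra

variable (k A B M X : Type u) [CommRing k] [Ring A] [Algebra k A] [Ring B] [Algebra k B]
  [AddCommGroup M] [Module k M] [Module A M] [Module Bᵐᵒᵖ M] [SMulCommClass A Bᵐᵒᵖ M]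
  [IsScalarTower k A M] [IsScalarTower k Bᵐᵒᵖ M]
  [AddCommGroup X] [Module k X] [Module (TriangularAlgebra A M B) X]
  [Module (TriangularAlgebra A M B)ᵐᵒᵖ X]
  [SMulCommClass (TriangularAlgebra A M B) (TriangularAlgebra A M B)ᵐᵒᵖ X]
  [IsScalarTower k (TriangularAlgebra A M B) X]
  [IsScalarTower k (TriangularAlgebra A M B)ᵐᵒᵖ X]

/-- The `A`-bimodule `X_AA = 1_A X 1_A`. -/
abbrev CornerAA : Type u := Corner X (inclA k A M B) (inclA k A M B)

/-- The `B`-bimodule `X_BB = 1_B X 1_B`. -/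
abbrev CornerBB : Type u := Corner X (inclB k A M B) (inclB k A M B)

/-- The `(B, A)`-bimodule `X_BA = 1_B X 1_A`. -/
abbrev CornerBA : Type u := Corner X (inclB k A M B) (inclA k A M B)

end TriangularAlgebra

/-! ### Hochschild homology -/

namespace Hochschild

variable (k C X : Type u) [CommRing k] [Ring C] [Algebra k C]
  [AddCommGroup X] [Module k X] [Module C X] [Module Cᵐᵒᵖ X] [SMulCommClass C Cᵐᵒᵖ X]
  [IsScalarTower k C X] [IsScalarTower k Cᵐᵒᵖ X]

/-- The module `X ⊗ C ⊗ ⋯ ⊗ C` of Hochschild `n`-chains, with `n` factors `C`. -/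
def chain : ℕ → ModuleCat.{u} k
  | 0 => ModuleCat.of k X
  | n + 1 => ModuleCat.of k (chain n ⊗[k] C)

/-- The left action of `C` on `X ⊗ C ⊗ ⋯ ⊗ C` through the factor `X`:
`c, x ⊗ c₁ ⊗ ⋯ ⊗ cₙ ↦ (c x) ⊗ c₁ ⊗ ⋯ ⊗ cₙ`. -/
def lact : ∀ n : ℕ, C →ₗ[k] (chain k C X n →ₗ[k] chain k C X n)
  | 0 => (Algebra.lsmul k k X : C →ₐ[k] Module.End k X).toLinearMap
  | n + 1 => LinearMap.rTensorHom C ∘ₗ lact n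

/-- The right action of `C` on `X ⊗ C ⊗ ⋯ ⊗ C` through the last factor:
`c, x ⊗ c₁ ⊗ ⋯ ⊗ cₙ ↦ x ⊗ c₁ ⊗ ⋯ ⊗ (cₙ c)`, and `c, x ↦ x c` if there is no factor `C`. -/
def ract : ∀ n : ℕ, C →ₗ[k] (chain k C X n →ₗ[k] chain k C X n)
  | 0 => (Algebra.lsmul k k X : Cᵐᵒᵖ →ₐ[k] Module.End k X).toLinearMap ∘ₗ
      (opLinearEquiv k : C ≃ₗ[k] Cᵐᵒᵖ).toLinearMap
  | n + 1 => LinearMap.lTensorHom (chain k C X n) ∘ₗ (LinearMap.mul k C).flip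

/-- `x ⊗ c₁ ⊗ ⋯ ⊗ cₙ₊₁ ↦ x ⊗ c₁ ⊗ ⋯ ⊗ cₙ cₙ₊₁`, and `x ⊗ c₁ ↦ x c₁` for `n = 0`. -/
def rightFace (n : ℕ) : chain k C X (n + 1) →ₗ[k] chain k C X n :=
  TensorProduct.lift (ract k C X n).flip

/-- `x ⊗ c₁ ⊗ ⋯ ⊗ cₙ₊₁ ↦ cₙ₊₁ x ⊗ c₁ ⊗ ⋯ ⊗ cₙ`. -/
def cyclicFace (n : ℕ) : chain k C X (n + 1) →ₗ[k] chain k C X n :=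
  TensorProduct.lift (lact k C X n).flip

/-- The map `z ⊗ c ↦ f(z) ⊗ c`. -/
def rTensorC {m n : ℕ} (f : chain k C X m →ₗ[k] chain k C X n) :
    chain k C X (m + 1) →ₗ[k] chain k C X (n + 1) :=
  LinearMap.rTensor C f

/-- The map
`x ⊗ c₁ ⊗ ⋯ ⊗ cₙ₊₁ ↦ x c₁ ⊗ c₂ ⊗ ⋯ ⊗ cₙ₊₁ + ∑ᵢ (-1)ⁱ x ⊗ c₁ ⊗ ⋯ ⊗ cᵢ cᵢ₊₁ ⊗ ⋯ ⊗ cₙ₊₁`,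
where `1 ≤ i ≤ n`. For `z` of degree `n` it satisfies
`b'(z ⊗ c) = b'(z) ⊗ c + (-1)ⁿ z c`, the first summand being absent for `n = 0`. -/
def bPrime : ∀ n : ℕ, chain k C X (n + 1) →ₗ[k] chain k C X n
  | 0 => rightFace k C X 0
  | n + 1 => rTensorC k C X (bPrime n) + (-1 : k) ^ (n + 1) • rightFace k C X (n + 1)

/-- The Hochschild boundary: `bPrime` plus the cyclic term
`(-1)ⁿ⁺¹ cₙ₊₁ x ⊗ c₁ ⊗ ⋯ ⊗ cₙ`. -/
def b (n : ℕ) : chain k C X (n + 1) →ₗ[k] chain k C X n :=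
  bPrime k C X n + (-1 : k) ^ (n + 1) • cyclicFace k C X n

/-- The pure tensor `z ⊗ c`. -/
def tmul {n : ℕ} (z : chain k C X n) (c : C) : chain k C X (n + 1) := z ⊗ₜ[k] c

variable {k C X}

theorem hom_ext {n : ℕ} {Y : Type u} [AddCommGroup Y] [Module k Y]
    {f g : chain k C X (n + 1) →ₗ[k] Y}
    (h : ∀ z c, f (tmul k C X z c) = g (tmul k C X z c)) : f = g :=
  TensorProduct.ext' h

theorem tmul_add_left {n : ℕ} (z z' : chain k C X n) (c : C) :
    tmul k C X (z + z') c = tmul k C X z c + tmul k C X z' c := TensorProduct.add_tmul _ _ _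

theorem tmul_smul_left {n : ℕ} (r : k) (z : chain k C X n) (c : C) :
    tmul k C X (r • z) c = r • tmul k C X z c := rfl

theorem rightFace_tmul {n : ℕ} (z : chain k C X n) (c : C) :
    rightFace k C X n (tmul k C X z c) = ract k C X n c z := rfl

theorem cyclicFace_tmul {n : ℕ} (z : chain k C X n) (c : C) :
    cyclicFace k C X n (tmul k C X z c) = lact k C X n c z := rfl

theorem ract_tmul {n : ℕ} (z : chain k C X n) (c d : C) :
    ract k C X (n + 1) d (tmul k C X z c) = tmul k C X z (c * d) := rfl

theorem lact_tmul {n : ℕ} (z : chain k C X n) (c d : C) :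
    lact k C X (n + 1) d (tmul k C X z c) = tmul k C X (lact k C X n d z) c := rfl

theorem bPrime_zero_tmul (z : chain k C X 0) (c : C) :
    bPrime k C X 0 (tmul k C X z c) = ract k C X 0 c z := rfl

theorem bPrime_succ_tmul {n : ℕ} (z : chain k C X (n + 1)) (c : C) :
    bPrime k C X (n + 1) (tmul k C X z c) =
      tmul k C X (bPrime k C X n z) c + (-1 : k) ^ (n + 1) • ract k C X (n + 1) c z := rfl

theorem b_apply {n : ℕ} (z : chain k C X (n + 1)) :
    b k C X n z = bPrime k C X n z + (-1 : k) ^ (n + 1) • cyclicFace k C X n z := rfl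

theorem ract_mul {n : ℕ} (c d : C) (z : chain k C X n) :
    ract k C X n (c * d) z = ract k C X n d (ract k C X n c z) := by
  cases n with
  | zero => exact mul_smul (β := X) (op d) (op c) z
  | succ n =>
    refine LinearMap.congr_fun (f := ract k C X (n + 1) (c * d))
      (g := ract k C X (n + 1) d ∘ₗ ract k C X (n + 1) c) (hom_ext fun z e => ?_) z
    simp only [LinearMap.comp_apply, ract_tmul, mul_assoc]

theorem lact_mul {n : ℕ} (c d : C) (z : chain k C X n) :
    lact k C X n (c * d) z = lact k C X n c (lact k C X n d z) := by
  induction n with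
  | zero => exact mul_smul (β := X) c d z
  | succ n ih =>
    refine LinearMap.congr_fun (f := lact k C X (n + 1) (c * d))
      (g := lact k C X (n + 1) c ∘ₗ lact k C X (n + 1) d) (hom_ext fun z e => ?_) z
    simp only [LinearMap.comp_apply, lact_tmul, ih]

theorem lact_ract {n : ℕ} (c d : C) (z : chain k C X n) :
    lact k C X n c (ract k C X n d z) = ract k C X n d (lact k C X n c z) := by
  cases n with
  | zero => exact smul_comm (α := X) c (op d) z
  | succ n =>
    refine LinearMap.congr_fun (f := lact k C X (n + 1) c ∘ₗ ract k C X (n + 1) d)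
      (g := ract k C X (n + 1) d ∘ₗ lact k C X (n + 1) c) (hom_ext fun z e => ?_) z
    simp only [LinearMap.comp_apply, lact_tmul, ract_tmul]

theorem bPrime_ract {n : ℕ} (c : C) (z : chain k C X (n + 1)) :
    bPrime k C X n (ract k C X (n + 1) c z) = ract k C X n c (bPrime k C X n z) := by
  refine LinearMap.congr_fun (f := bPrime k C X n ∘ₗ ract k C X (n + 1) c)
    (g := ract k C X n c ∘ₗ bPrime k C X n) (hom_ext fun z e => ?_) z
  cases n with
  | zero => simp only [LinearMap.comp_apply, ract_tmul, bPrime_zero_tmul, ract_mul]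
  | succ n =>
    simp only [LinearMap.comp_apply, ract_tmul, bPrime_succ_tmul, ract_mul, map_add, map_smul]

theorem bPrime_lact {n : ℕ} (c : C) (z : chain k C X (n + 1)) :
    bPrime k C X n (lact k C X (n + 1) c z) = lact k C X n c (bPrime k C X n z) := by
  induction n with
  | zero =>
    refine LinearMap.congr_fun (f := bPrime k C X 0 ∘ₗ lact k C X 1 c)
      (g := lact k C X 0 c ∘ₗ bPrime k C X 0) (hom_ext fun z e => ?_) z
    simp only [LinearMap.comp_apply, lact_tmul, bPrime_zero_tmul, lact_ract]
  | succ n ih =>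
    refine LinearMap.congr_fun (f := bPrime k C X (n + 1) ∘ₗ lact k C X (n + 2) c)
      (g := lact k C X (n + 1) c ∘ₗ bPrime k C X (n + 1)) (hom_ext fun z e => ?_) z
    simp only [LinearMap.comp_apply, lact_tmul, bPrime_succ_tmul, ih, map_add, map_smul, lact_ract]

theorem bPrime_bPrime {n : ℕ} (z : chain k C X (n + 2)) :
    bPrime k C X n (bPrime k C X (n + 1) z) = 0 := by
  induction n with
  | zero =>
    refine LinearMap.congr_fun (f := bPrime k C X 0 ∘ₗ bPrime k C X 1) (g := 0)
      (hom_ext fun z e => ?_) z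
    simp only [LinearMap.comp_apply, bPrime_succ_tmul, bPrime_zero_tmul, map_add, map_smul,
      bPrime_ract, LinearMap.zero_apply]
    simp
  | succ n ih =>
    refine LinearMap.congr_fun (f := bPrime k C X (n + 1) ∘ₗ bPrime k C X (n + 2)) (g := 0)
      (hom_ext fun z e => ?_) z
    have h0 : tmul k C X (0 : chain k C X n) e = 0 := TensorProduct.zero_tmul _ _
    rw [LinearMap.comp_apply, bPrime_succ_tmul, map_add, map_smul, bPrime_succ_tmul, ih,
      bPrime_ract, h0, LinearMap.zero_apply, pow_succ (-1 : k) (n + 1)]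
    simp

theorem b_b {n : ℕ} (z : chain k C X (n + 2)) : b k C X n (b k C X (n + 1) z) = 0 := by
  refine LinearMap.congr_fun (f := b k C X n ∘ₗ b k C X (n + 1)) (g := 0)
    (hom_ext fun z e => ?_) z
  have h : cyclicFace k C X n (ract k C X (n + 1) e z) =
      cyclicFace k C X n (lact k C X (n + 1) e z) := by
    refine LinearMap.congr_fun (f := cyclicFace k C X n ∘ₗ ract k C X (n + 1) e)
      (g := cyclicFace k C X n ∘ₗ lact k C X (n + 1) e) (hom_ext fun z c => ?_) z
    simp only [LinearMap.comp_apply, ract_tmul, lact_tmul, cyclicFace_tmul, lact_mul]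
  have hs : (-1 : k) ^ (n + 1) * (-1 : k) ^ (n + 1) = 1 := by
    rw [← mul_pow, neg_one_mul, neg_neg, one_pow]
  simp only [LinearMap.comp_apply, b_apply, map_add, map_smul, bPrime_bPrime, cyclicFace_tmul,
    bPrime_lact, LinearMap.zero_apply]
  rw [bPrime_succ_tmul, map_add, map_smul, cyclicFace_tmul, h]
  rw [pow_succ (-1 : k) (n + 1)]
  simp only [smul_add, smul_smul, mul_neg, mul_one, neg_smul, neg_mul, hs, one_smul]
  abel

end Hochschild

section

variable (k C X : Type u) [CommRing k] [Ring C] [Algebra k C]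
  [AddCommGroup X] [Module k X] [Module C X] [Module Cᵐᵒᵖ X] [SMulCommClass C Cᵐᵒᵖ X]
  [IsScalarTower k C X] [IsScalarTower k Cᵐᵒᵖ X]

/-- The Hochschild complex of the `k`-algebra `C` with coefficients in the `C`-bimodule `X`. -/
def hochschildComplex : ChainComplex (ModuleCat.{u} k) ℕ :=
  ChainComplex.of (Hochschild.chain k C X) (fun n => ModuleCat.ofHom (Hochschild.b k C X n))
    (fun _ => ModuleCat.hom_ext (LinearMap.ext fun z => Hochschild.b_b z))

/-- The Hochschild homology `H_n(C, X)`. -/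
abbrev HochschildHomology (n : ℕ) : ModuleCat.{u} k := (hochschildComplex k C X).homology n

end

/-! ### Relative Tor -/

section RelTor

variable (k R : Type u) [CommRing k] [Ring R] [Algebra k R]

/-- An `R`-module is relatively projective if it has the lifting property with respect to all
`R`-linear epimorphisms that split as `k`-linear maps. -/
def IsRelProjective (Q : Type u) [AddCommGroup Q] [Module R Q] : Prop :=
  ∀ (Y Z : Type u) [AddCommGroup Y] [AddCommGroup Z] [Module k Y] [Module k Z]
    [Module R Y] [Module R Z] [IsScalarTower k R Y] [IsScalarTower k R Z]
    (g : Y →ₗ[R] Z) (s : Z →ₗ[k] Y), (∀ z, g (s z) = z) →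
    ∀ h : Q →ₗ[R] Z, ∃ l : Q →ₗ[R] Y, ∀ q, g (l q) = h q

variable (M : Type u) [AddCommGroup M] [Module k M] [Module R M] [IsScalarTower k R M]

/-- A projective resolution `⋯ → P₁ → P₀ → M → 0` of the left `R`-module `M`, relative to the
family of the `R`-linear epimorphisms that split `k`-linearly: the modules `Pₙ` are relatively
projective and the augmented complex is contractible as a complex of `k`-modules. -/
structure RelProjResolution where
  P : ℕ → Type u
  [addCommGroup : ∀ n, AddCommGroup (P n)]
  [moduleBase : ∀ n, Module k (P n)]
  [module : ∀ n, Module R (P n)]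
  [isScalarTower : ∀ n, IsScalarTower k R (P n)]
  d : ∀ n, P (n + 1) →ₗ[R] P n
  ε : P 0 →ₗ[R] M
  d_d : ∀ n x, d n (d (n + 1) x) = 0
  ε_d : ∀ x, ε (d 0 x) = 0
  relProjective : ∀ n, IsRelProjective k R (P n)
  contractible : ∃ (s₀ : M →ₗ[k] P 0) (s : ∀ n, P n →ₗ[k] P (n + 1)),
    (∀ m, ε (s₀ m) = m) ∧ (∀ x, d 0 (s 0 x) + s₀ (ε x) = x) ∧
    (∀ n x, d (n + 1) (s (n + 1) x) + s n (d n x) = x)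

attribute [instance] RelProjResolution.addCommGroup RelProjResolution.moduleBase
  RelProjResolution.module RelProjResolution.isScalarTower

/-! The bar resolution shows that relative projective resolutions exist. -/

namespace BarResolution

/-- `R ⊗ ⋯ ⊗ R ⊗ M` with `n` factors `R`. -/
def obj : ℕ → ModuleCat.{u} k
  | 0 => ModuleCat.of k M
  | n + 1 => ModuleCat.of k (R ⊗[k] obj n)

/-- `R` acts on `R ⊗ ⋯ ⊗ R ⊗ M` through the first factor. -/
instance instModule : ∀ n : ℕ, Module R (obj k R M n)
  | 0 => inferInstanceAs (Module R M)
  | n + 1 => inferInstanceAs (Module R (R ⊗[k] obj k R M n))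

instance instIsScalarTower : ∀ n : ℕ, IsScalarTower k R (obj k R M n)
  | 0 => inferInstanceAs (IsScalarTower k R M)
  | n + 1 => inferInstanceAs (IsScalarTower k R (R ⊗[k] obj k R M n))

/-- The pure tensor `r ⊗ w`. -/
def tmul {n : ℕ} (r : R) (w : obj k R M n) : obj k R M (n + 1) := r ⊗ₜ[k] w

/-- The map `w ↦ 1 ⊗ w`. -/
def unit (n : ℕ) : obj k R M n →ₗ[k] obj k R M (n + 1) := TensorProduct.mk k R (obj k R M n) 1

/-- The map `r ⊗ w ↦ r w`. -/
def act (n : ℕ) : obj k R M (n + 1) →ₗ[k] obj k R M n :=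
  TensorProduct.lift (Algebra.lsmul k k (obj k R M n) : R →ₐ[k] Module.End k _).toLinearMap

/-- The map `r ⊗ w ↦ r ⊗ f(w)`. -/
def lTensorR {m n : ℕ} (f : obj k R M m →ₗ[k] obj k R M n) :
    obj k R M (m + 1) →ₗ[k] obj k R M (n + 1) :=
  LinearMap.lTensor R f

/-- The bar differential: `r ⊗ m ↦ r m` in degree `0`, and `r ⊗ w ↦ r w - r ⊗ d(w)` in higher
degrees. -/
def diff : ∀ n : ℕ, obj k R M (n + 1) →ₗ[k] obj k R M n
  | 0 => act k R M 0
  | n + 1 => act k R M (n + 1) - lTensorR k R M (diff n)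

variable {k R M}

theorem obj_induction {n : ℕ} {p : obj k R M (n + 1) → Prop} (z : obj k R M (n + 1))
    (h0 : p 0) (ht : ∀ r w, p (tmul k R M r w)) (ha : ∀ x y, p x → p y → p (x + y)) : p z :=
  TensorProduct.induction_on z h0 ht ha

theorem smul_tmul {n : ℕ} (r s : R) (w : obj k R M n) :
    r • tmul k R M s w = tmul k R M (r * s) w := rfl

theorem diff_zero_tmul (r : R) (w : obj k R M 0) : diff k R M 0 (tmul k R M r w) = r • w := rfl

theorem diff_succ_tmul {n : ℕ} (r : R) (w : obj k R M (n + 1)) :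
    diff k R M (n + 1) (tmul k R M r w) = r • w - tmul k R M r (diff k R M n w) := rfl

theorem diff_smul {n : ℕ} (r : R) (z : obj k R M (n + 1)) :
    diff k R M n (r • z) = r • diff k R M n z := by
  induction z using obj_induction with
  | h0 => simp only [smul_zero, map_zero]
  | ht s w =>
    cases n with
    | zero => rw [smul_tmul, diff_zero_tmul, diff_zero_tmul, mul_smul]
    | succ n => rw [smul_tmul, diff_succ_tmul, diff_succ_tmul, mul_smul, smul_sub, smul_tmul]
  | ha x y hx hy => simp only [smul_add, map_add, hx, hy]

theorem diff_diff {n : ℕ} (z : obj k R M (n + 2)) :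
    diff k R M n (diff k R M (n + 1) z) = 0 := by
  induction n with
  | zero =>
    induction z using obj_induction with
    | h0 => simp only [map_zero]
    | ht s w => rw [diff_succ_tmul, map_sub, diff_smul, diff_zero_tmul, sub_self]
    | ha x y hx hy => simp only [map_add, hx, hy, add_zero]
  | succ n ih =>
    induction z using obj_induction with
    | h0 => simp only [map_zero]
    | ht s w =>
      have h0 : tmul k R M s (0 : obj k R M n) = 0 := TensorProduct.tmul_zero _ _
      rw [diff_succ_tmul, map_sub, diff_smul, diff_succ_tmul, ih, h0, sub_zero, sub_self]
    | ha x y hx hy => simp only [map_add, hx, hy, add_zero]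

variable (k R) in
/-- Modules of the form `R ⊗ W` are relatively projective. -/
theorem isRelProjective_tensor (W : Type u) [AddCommGroup W] [Module k W] :
    IsRelProjective k R (R ⊗[k] W) := by
  intro Y Z _ _ _ _ _ _ _ _ g s hs h
  refine ⟨TensorProduct.AlgebraTensorModule.lift
    ((LinearMap.toSpanSingleton R (W →ₗ[k] Y)
      (s ∘ₗ h.restrictScalars k ∘ₗ TensorProduct.mk k R W 1))), fun q => ?_⟩
  induction q with
  | zero => simp only [map_zero]
  | add x y hx hy => simp only [map_add, hx, hy]
  | tmul r w =>
    simp only [TensorProduct.AlgebraTensorModule.lift_tmul, LinearMap.toSpanSingleton_apply,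
      LinearMap.smul_apply, map_smul, LinearMap.comp_apply, hs]
    rw [LinearMap.restrictScalars_apply, ← map_smul, TensorProduct.mk_apply,
      TensorProduct.smul_tmul', smul_eq_mul, mul_one]

end BarResolution

/-- The bar resolution of `M`. -/
def barResolution : RelProjResolution k R M where
  P n := BarResolution.obj k R M (n + 1)
  d n := { BarResolution.diff k R M (n + 1) with map_smul' := BarResolution.diff_smul }
  ε := { BarResolution.diff k R M 0 with map_smul' := BarResolution.diff_smul (n := 0) }
  d_d _ := BarResolution.diff_diff
  ε_d := BarResolution.diff_diff
  relProjective n := BarResolution.isRelProjective_tensor k R (BarResolution.obj k R M n)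
  contractible := by
    refine ⟨BarResolution.unit k R M 0, fun n => BarResolution.unit k R M (n + 1),
      fun m => one_smul R m, fun x => ?_, fun n x => ?_⟩
    · change (1 : R) • x - BarResolution.tmul k R M 1 (BarResolution.diff k R M 0 x) +
        BarResolution.tmul k R M 1 (BarResolution.diff k R M 0 x) = x
      rw [one_smul, sub_add_cancel]
    · change (1 : R) • x - BarResolution.tmul k R M 1 (BarResolution.diff k R M (n + 1) x) +
        BarResolution.tmul k R M 1 (BarResolution.diff k R M (n + 1) x) = x
      rw [one_smul, sub_add_cancel]

/-! The tensor product over a noncommutative algebra. -/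

variable {k R M} (N : Type u) [AddCommGroup N] [Module k N] [Module Rᵐᵒᵖ N] [IsScalarTower k Rᵐᵒᵖ N]

variable (k R) in
/-- The submodule of `N ⊗[k] Q` spanned by the elements `n r ⊗ q - n ⊗ r q`. -/
def balancedSubmodule (Q : Type u) [AddCommGroup Q] [Module k Q] [Module R Q]
    [IsScalarTower k R Q] : Submodule k (N ⊗[k] Q) :=
  Submodule.span k {t | ∃ (n : N) (r : R) (q : Q), t = (op r • n) ⊗ₜ[k] q - n ⊗ₜ[k] (r • q)}

variable (k R) in
/-- The `k`-module `N ⊗_R Q`, for a right `R`-module `N` and a left `R`-module `Q`. -/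
abbrev BalancedTensor (Q : Type u) [AddCommGroup Q] [Module k Q] [Module R Q]
    [IsScalarTower k R Q] : Type u :=
  (N ⊗[k] Q) ⧸ balancedSubmodule k R N Q

variable (k) in
/-- The map `N ⊗_R f`. -/
def balancedMap {Q Q' : Type u} [AddCommGroup Q] [Module k Q] [Module R Q] [IsScalarTower k R Q]
    [AddCommGroup Q'] [Module k Q'] [Module R Q'] [IsScalarTower k R Q'] (f : Q →ₗ[R] Q') :
    BalancedTensor k R N Q →ₗ[k] BalancedTensor k R N Q' :=
  Submodule.mapQ _ _ (LinearMap.lTensor N (f.restrictScalars k)) (by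
    rw [balancedSubmodule, Submodule.span_le]
    rintro _ ⟨n, r, q, rfl⟩
    refine Submodule.subset_span ⟨n, r, f q, ?_⟩
    simp)

/-- The complex `N ⊗_R P` of `k`-modules. -/
def relTorComplex (P : RelProjResolution k R M) : ChainComplex (ModuleCat.{u} k) ℕ :=
  ChainComplex.of (fun n => ModuleCat.of k (BalancedTensor k R N (P.P n)))
    (fun n => ModuleCat.ofHom (balancedMap k N (P.d n)))
    (fun n => by
      refine ModuleCat.hom_ext (Submodule.linearMap_qext _ (TensorProduct.ext' fun x y => ?_))
      simp [balancedMap, P.d_d])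

/-- The relative Tor group `Tor_n^{R,k}(M, N)` of the left `R`-module `M` and the right
`R`-module `N`, computed from the relative projective resolution `P` of `M`. -/
abbrev RelTor (P : RelProjResolution k R M) (n : ℕ) : ModuleCat.{u} k :=
  (relTorComplex N P).homology n

end RelTor

/-! ### Bimodules as modules over `A ⊗ Bᵒᵖ` -/

section Bimodule

variable (k A B M N : Type u) [CommRing k] [Ring A] [Algebra k A] [Ring B] [Algebra k B]

section Left

variable [AddCommGroup M] [Module k M] [Module A M] [Module Bᵐᵒᵖ M] [SMulCommClass A Bᵐᵒᵖ M]
  [IsScalarTower k A M] [IsScalarTower k Bᵐᵒᵖ M]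

/-- An `(A, B)`-bimodule is a left `A ⊗ Bᵒᵖ`-module by `(a ⊗ b) m = a m b`. -/
abbrev bimoduleLeft : Module (A ⊗[k] Bᵐᵒᵖ) M := TensorProduct.Algebra.module

theorem bimoduleLeft_smul (a : A) (b : B) (m : M) :
    letI := bimoduleLeft k A B M
    (a ⊗ₜ[k] op b : A ⊗[k] Bᵐᵒᵖ) • m = a • op b • m := rfl

theorem bimoduleLeft_isScalarTower :
    letI := bimoduleLeft k A B M
    IsScalarTower k (A ⊗[k] Bᵐᵒᵖ) M :=
  letI := bimoduleLeft k A B M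
  ⟨fun c x m => by
    change TensorProduct.Algebra.moduleAux (c • x) m = c • TensorProduct.Algebra.moduleAux x m
    rw [map_smul, LinearMap.smul_apply]⟩

/-- Relative projective resolutions of the `(A, B)`-bimodule `M`, as a left
`A ⊗ Bᵒᵖ`-module. -/
abbrev BimoduleResolution :=
  letI := bimoduleLeft k A B M
  haveI := bimoduleLeft_isScalarTower k A B M
  RelProjResolution k (A ⊗[k] Bᵐᵒᵖ) M

end Left

section Right

variable [AddCommGroup N] [Module k N] [Module B N] [Module Aᵐᵒᵖ N] [SMulCommClass B Aᵐᵒᵖ N]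
  [IsScalarTower k B N] [IsScalarTower k Aᵐᵒᵖ N]

/-- The algebra isomorphism `(A ⊗ Bᵒᵖ)ᵒᵖ ≃ Aᵒᵖ ⊗ B`. -/
def opTensorOp : (A ⊗[k] Bᵐᵒᵖ)ᵐᵒᵖ ≃ₐ[k] Aᵐᵒᵖ ⊗[k] B :=
  (Algebra.TensorProduct.opAlgEquiv k k A Bᵐᵒᵖ).symm.trans
    (Algebra.TensorProduct.congr AlgEquiv.refl (AlgEquiv.opOp k B).symm)

/-- A `(B, A)`-bimodule is a right `A ⊗ Bᵒᵖ`-module by `n (a ⊗ b) = b n a`. -/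
abbrev bimoduleRight : Module (A ⊗[k] Bᵐᵒᵖ)ᵐᵒᵖ N :=
  haveI : SMulCommClass Aᵐᵒᵖ B N := SMulCommClass.symm _ _ _
  letI : Module (Aᵐᵒᵖ ⊗[k] B) N := TensorProduct.Algebra.module
  Module.compHom N (opTensorOp k A B).toRingEquiv.toRingHom

theorem bimoduleRight_smul (a : A) (b : B) (n : N) :
    letI := bimoduleRight k A B N
    (op (a ⊗ₜ[k] op b) : (A ⊗[k] Bᵐᵒᵖ)ᵐᵒᵖ) • n = op a • b • n := rfl

theorem bimoduleRight_isScalarTower :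
    letI := bimoduleRight k A B N
    IsScalarTower k (A ⊗[k] Bᵐᵒᵖ)ᵐᵒᵖ N :=
  letI := bimoduleRight k A B N
  ⟨fun c x n => by
    change TensorProduct.Algebra.moduleAux (opTensorOp k A B (c • x)) n =
      c • TensorProduct.Algebra.moduleAux (opTensorOp k A B x) n
    rw [map_smul, map_smul, LinearMap.smul_apply]⟩

end Right

variable {k A B M}

/-- The relative Tor group `Tor_n^{A ⊗ Bᵒᵖ, k}(M, N)` of an `(A, B)`-bimodule `M` and a
`(B, A)`-bimodule `N`, computed from the relative projective resolution `P` of `M`. -/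
abbrev BimoduleTor
    [AddCommGroup M] [Module k M] [Module A M] [Module Bᵐᵒᵖ M] [SMulCommClass A Bᵐᵒᵖ M]
    [IsScalarTower k A M] [IsScalarTower k Bᵐᵒᵖ M]
    [AddCommGroup N] [Module k N] [Module B N] [Module Aᵐᵒᵖ N] [SMulCommClass B Aᵐᵒᵖ N]
    [IsScalarTower k B N] [IsScalarTower k Aᵐᵒᵖ N]
    (P : BimoduleResolution k A B M) (n : ℕ) : ModuleCat.{u} k :=
  letI := bimoduleLeft k A B M
  haveI := bimoduleLeft_isScalarTower k A B M
  letI := bimoduleRight k A B N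
  haveI := bimoduleRight_isScalarTower k A B N
  RelTor N P n

end Bimodule

end

open scoped TensorProduct
open MulOpposite

noncomputable section

set_option linter.unusedSectionVars false

open CategoryTheory in
/-- The long exact homology sequence of a degreewise short exact sequence of chain complexes of
modules, in terms of linear maps. -/
theorem exists_exact_homology_sequence {k : Type u} [CommRing k]
    {K L N : ChainComplex (ModuleCat.{u} k) ℕ} (i : K ⟶ L) (p : L ⟶ N)
    (hi : ∀ n, Function.Injective (i.f n).hom) (hp : ∀ n, Function.Surjective (p.f n).hom)
    (hip : ∀ n, Function.Exact (i.f n).hom (p.f n).hom) :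
    ∃ (f : ∀ n, K.homology n →ₗ[k] L.homology n) (g : ∀ n, L.homology n →ₗ[k] N.homology n)
      (δ : ∀ n, N.homology (n + 1) →ₗ[k] K.homology n),
      (∀ n, Function.Exact (f n) (g n)) ∧ (∀ n, Function.Exact (g (n + 1)) (δ n)) ∧
      (∀ n, Function.Exact (δ n) (f n)) ∧ Function.Surjective (g 0) := by
  have w : i ≫ p = 0 := by
    ext n x
    exact (hip n).apply_apply_eq_zero x
  let S : ShortComplex (ChainComplex (ModuleCat.{u} k) ℕ) := ShortComplex.mk i p w
  have hS : S.ShortExact := by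
    refine HomologicalComplex.shortExact_of_degreewise_shortExact S fun n => ?_
    have h1 : Mono (S.map (HomologicalComplex.eval _ _ n)).f :=
      (ModuleCat.mono_iff_injective _).2 (hi n)
    have h2 : Epi (S.map (HomologicalComplex.eval _ _ n)).g :=
      (ModuleCat.epi_iff_surjective _).2 (hp n)
    exact ⟨(ShortComplex.ShortExact.moduleCat_exact_iff_function_exact _).2 (hip n)⟩
  refine ⟨fun n => (HomologicalComplex.homologyMap i n).hom,
    fun n => (HomologicalComplex.homologyMap p n).hom,
    fun n => (hS.δ (n + 1) n rfl).hom, fun n => ?_, fun n => ?_, fun n => ?_, ?_⟩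
  · exact (ShortComplex.ShortExact.moduleCat_exact_iff_function_exact _).1 (hS.homology_exact₂ n)
  · exact (ShortComplex.ShortExact.moduleCat_exact_iff_function_exact _).1
      (hS.homology_exact₃ (n + 1) n rfl)
  · exact (ShortComplex.ShortExact.moduleCat_exact_iff_function_exact _).1
      (hS.homology_exact₁ (n + 1) n rfl)
  · have := hS.epi_g
    have hι : ∀ (K : ChainComplex (ModuleCat.{u} k) ℕ), IsIso (K.homologyι 0) :=
      fun K => ShortComplex.isIso_homologyι (K.sc 0) (K.shape _ _ (by simp))
    have : IsIso (L.homologyι 0) := hι L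
    have : IsIso (N.homologyι 0) := hι N
    have : Epi p := hS.epi_g
    have : Epi (HomologicalComplex.homologyMap p 0 ≫ N.homologyι 0) := by
      rw [HomologicalComplex.homologyι_naturality]
      infer_instance
    have : Epi (HomologicalComplex.homologyMap p 0) := by
      rw [← Category.comp_id (HomologicalComplex.homologyMap p 0),
        ← IsIso.hom_inv_id (N.homologyι 0), ← Category.assoc]
      infer_instance
    exact (ModuleCat.epi_iff_surjective _).1 this

open CategoryTheory in
/-- A family of maps raising the degree by one defines a null-homotopy. -/
theorem exists_homotopy_of_family {k : Type u} [CommRing k]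
    {K L : ChainComplex (ModuleCat.{u} k) ℕ} (f g : K ⟶ L) (h : ∀ n, K.X n ⟶ L.X (n + 1))
    (h0 : f.f 0 - g.f 0 = h 0 ≫ L.d 1 0)
    (hs : ∀ n, f.f (n + 1) - g.f (n + 1) =
      K.d (n + 1) n ≫ h n + h (n + 1) ≫ L.d (n + 2) (n + 1)) :
    Nonempty (Homotopy f g) := by
  let H : ∀ i j, (ComplexShape.down ℕ).Rel j i → (K.X i ⟶ L.X j) :=
    fun i j r => h i ≫ eqToHom (by rw [← (show i + 1 = j from r)])
  have e : f - g = Homotopy.nullHomotopicMap' H := by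
    ext1 n
    cases n with
    | zero =>
      rw [Homotopy.nullHomotopicMap'_f_of_not_rel_left (k₁ := 1) (by simp) (by simp)]
      simpa [H] using h0
    | succ n =>
      rw [Homotopy.nullHomotopicMap'_f (k₂ := n + 2) (k₀ := n) (by simp) (by simp)]
      simpa [H] using hs n
  exact ⟨Homotopy.equivSubZero.symm ((Homotopy.ofEq e).trans (Homotopy.nullHomotopy' H))⟩

open CategoryTheory in
/-- Mutually inverse maps up to homotopy induce isomorphisms in homology. -/
theorem exists_homology_linearEquiv {k : Type u} [CommRing k]
    {K L : ChainComplex (ModuleCat.{u} k) ℕ} (f : K ⟶ L) (g : L ⟶ K)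
    (hfg : Nonempty (Homotopy (f ≫ g) (𝟙 K))) (hgf : Nonempty (Homotopy (g ≫ f) (𝟙 L))) (n : ℕ) :
    Nonempty (K.homology n ≃ₗ[k] L.homology n) := by
  obtain ⟨h⟩ := hfg
  obtain ⟨h'⟩ := hgf
  let e : HomotopyEquiv K L := ⟨f, g, h, h'⟩
  exact ⟨(e.toHomologyIso n).toLinearEquiv⟩

/-- Dependent choice for sequences. -/
theorem exists_seq_of_step {G : ℕ → Type*} (p : ∀ n, G n → Prop) (r : ∀ n, G n → G (n + 1) → Prop)
    (g₀ : G 0) (h₀ : p 0 g₀) (step : ∀ n g, p n g → ∃ g', p (n + 1) g' ∧ r n g g') :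
    ∃ g : ∀ n, G n, g 0 = g₀ ∧ ∀ n, r n (g n) (g (n + 1)) := by
  choose F hF using step
  let s : ∀ n, {g : G n // p n g} := fun n =>
    Nat.rec ⟨g₀, h₀⟩ (fun n g => ⟨F n g.1 g.2, (hF n g.1 g.2).1⟩) n
  exact ⟨fun n => (s n).1, rfl, fun n => (hF n (s n).1 (s n).2).2⟩

section RelProj

variable {k R : Type u} [CommRing k] [Ring R] [Algebra k R]

variable (k R) in
/-- The action map `R ⊗ Q → Q`. -/
def actionMap (Q : Type u) [AddCommGroup Q] [Module k Q] [Module R Q] [IsScalarTower k R Q] :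
    R ⊗[k] Q →ₗ[R] Q :=
  TensorProduct.AlgebraTensorModule.lift (LinearMap.toSpanSingleton R (Q →ₗ[k] Q) LinearMap.id)

@[simp]
theorem actionMap_tmul {Q : Type u} [AddCommGroup Q] [Module k Q] [Module R Q]
    [IsScalarTower k R Q] (r : R) (q : Q) : actionMap k R Q (r ⊗ₜ q) = r • q := rfl

/-- The action map of a relatively projective module splits. -/
theorem IsRelProjective.exists_section {Q : Type u} [AddCommGroup Q] [Module k Q] [Module R Q]
    [IsScalarTower k R Q] (hQ : IsRelProjective k R Q) :
    ∃ l : Q →ₗ[R] R ⊗[k] Q, ∀ q, actionMap k R Q (l q) = q :=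
  hQ (R ⊗[k] Q) Q (actionMap k R Q) (TensorProduct.mk k R Q 1) (fun z => by simp) LinearMap.id

/-- Lifting along a map that has a linear section over the image of the map to be lifted. -/
theorem IsRelProjective.exists_lift {Q Y Z : Type u} [AddCommGroup Q] [Module k Q] [Module R Q]
    [IsScalarTower k R Q] (hQ : IsRelProjective k R Q) [AddCommGroup Y] [Module k Y] [Module R Y]
    [IsScalarTower k R Y] [AddCommGroup Z] [Module k Z] [Module R Z] [IsScalarTower k R Z]
    (g : Y →ₗ[R] Z) (s : Z →ₗ[k] Y) (h : Q →ₗ[R] Z) (hs : ∀ q, g (s (h q)) = h q) :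
    ∃ l : Q →ₗ[R] Y, ∀ q, g (l q) = h q := by
  obtain ⟨l, hl⟩ := hQ.exists_section
  refine ⟨actionMap k R Y ∘ₗ TensorProduct.AlgebraTensorModule.map LinearMap.id
    (s ∘ₗ h.restrictScalars k) ∘ₗ l, fun q => ?_⟩
  have key : ∀ t : R ⊗[k] Q, g (actionMap k R Y (TensorProduct.AlgebraTensorModule.map
      (LinearMap.id : R →ₗ[R] R) (s ∘ₗ h.restrictScalars k) t)) = h (actionMap k R Q t) := by
    intro t
    induction t with
    | zero => simp only [map_zero]
    | add x y hx hy => simp only [map_add, hx, hy]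
    | tmul r q => simp [hs]
  rw [LinearMap.comp_apply, LinearMap.comp_apply, key, hl]

theorem IsRelProjective.prod {Q Q' : Type u} [AddCommGroup Q] [Module R Q] [AddCommGroup Q']
    [Module R Q'] (hQ : IsRelProjective k R Q) (hQ' : IsRelProjective k R Q') :
    IsRelProjective k R (Q × Q') := by
  intro Y Z _ _ _ _ _ _ _ _ g s hs h
  obtain ⟨l, hl⟩ := hQ Y Z g s hs (h ∘ₗ LinearMap.inl R Q Q')
  obtain ⟨l', hl'⟩ := hQ' Y Z g s hs (h ∘ₗ LinearMap.inr R Q Q')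
  refine ⟨l.coprod l', fun q => ?_⟩
  rw [LinearMap.coprod_apply, map_add, hl, hl', LinearMap.comp_apply, LinearMap.comp_apply,
    ← map_add]
  simp

/-- If `Q` is relatively projective, then so is `Q ⊗ W`, with `R` acting on `Q`. -/
theorem IsRelProjective.of_tensor_equiv {Q Q' W : Type u} [AddCommGroup Q] [Module k Q]
    [Module R Q] [IsScalarTower k R Q] (hQ : IsRelProjective k R Q) [AddCommGroup W] [Module k W]
    [AddCommGroup Q'] [Module k Q'] [Module R Q'] [IsScalarTower k R Q']
    (e : Q ⊗[k] W ≃ₗ[k] Q') (he : ∀ (r : R) q w, r • e (q ⊗ₜ w) = e ((r • q) ⊗ₜ w)) :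
    IsRelProjective k R Q' := by
  intro Y Z _ _ _ _ _ _ _ _ g s hs h
  let G : (W →ₗ[k] Y) →ₗ[R] (W →ₗ[k] Z) :=
    { toFun := fun f => g.restrictScalars k ∘ₗ f
      map_add' := fun a b => by ext; simp
      map_smul' := fun r a => by ext; simp }
  let h' : Q →ₗ[R] (W →ₗ[k] Z) :=
    { toFun := fun q => h.restrictScalars k ∘ₗ e.toLinearMap ∘ₗ TensorProduct.mk k Q W q
      map_add' := fun a b => by ext; simp
      map_smul' := fun r a => by
        ext w
        simp [← he] }
  obtain ⟨l, hl⟩ := hQ.exists_lift G (LinearMap.llcomp k W Z Y s) h' (fun q => by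
    ext w
    simp [G, hs])
  let l' : Q' →ₗ[k] Y := TensorProduct.lift (l.restrictScalars k) ∘ₗ e.symm.toLinearMap
  have hl' : ∀ q w, l' (e (q ⊗ₜ w)) = l q w := fun q w => by simp [l']
  have ind : ∀ {p : Q' → Prop} (h0 : p 0) (ht : ∀ q w, p (e (q ⊗ₜ w)))
      (ha : ∀ x y, p x → p y → p (x + y)) (x : Q'), p x := by
    intro p p0 pt pa x
    obtain ⟨t, rfl⟩ := e.surjective x
    induction t with
    | zero => simpa using p0
    | add x y hx hy => rw [map_add]; exact pa _ _ hx hy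
    | tmul q w => exact pt q w
  refine ⟨{ l' with map_smul' := fun r x => ?_ }, fun x => ?_⟩
  · change l' (r • x) = r • l' x
    induction x using ind with
    | h0 => simp
    | ht q w => rw [he, hl', hl', map_smul, LinearMap.smul_apply]
    | ha x y hx hy => rw [smul_add, map_add, map_add, smul_add, hx, hy]
  · change g (l' x) = h x
    induction x using ind with
    | h0 => simp
    | ht q w => rw [hl']; exact LinearMap.congr_fun (hl q) w
    | ha x y hx hy => rw [map_add, map_add, map_add, hx, hy]

end RelProj

namespace RelProjResolution

variable {k R : Type u} [CommRing k] [Ring R] [Algebra k R]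
  {M : Type u} [AddCommGroup M] [Module k M] [Module R M] [IsScalarTower k R M]

/-- The cycles of the augmented complex. -/
def IsCycle (T : RelProjResolution k R M) : ∀ n, T.P n → Prop
  | 0, y => T.ε y = 0
  | n + 1, y => T.d n y = 0

theorem exists_section_of_isCycle (T : RelProjResolution k R M) (n : ℕ) :
    ∃ s : T.P n →ₗ[k] T.P (n + 1), ∀ y, T.IsCycle n y → T.d n (s y) = y := by
  obtain ⟨s₀, s, -, h0, hs⟩ := T.contractible
  refine ⟨s n, fun y hy => ?_⟩
  cases n with
  | zero => simpa [show T.ε y = 0 from hy] using h0 y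
  | succ n => simpa [show T.d n y = 0 from hy] using hs n y

theorem exists_lift_of_isCycle (T : RelProjResolution k R M) {Q : Type u} [AddCommGroup Q]
    [Module k Q] [Module R Q] [IsScalarTower k R Q] (hQ : IsRelProjective k R Q) {n : ℕ}
    (f : Q →ₗ[R] T.P n) (hf : ∀ q, T.IsCycle n (f q)) :
    ∃ g : Q →ₗ[R] T.P (n + 1), ∀ q, T.d n (g q) = f q := by
  obtain ⟨s, hs⟩ := T.exists_section_of_isCycle n
  exact hQ.exists_lift (T.d n) s f fun q => hs _ (hf q)

/-- A map from a complex of relatively projective modules to the module resolved by `T` lifts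
to a chain map. -/
theorem exists_chain_lift (T : RelProjResolution k R M) {Q : ℕ → Type u}
    [∀ n, AddCommGroup (Q n)] [∀ n, Module k (Q n)] [∀ n, Module R (Q n)]
    [∀ n, IsScalarTower k R (Q n)] (hQ : ∀ n, IsRelProjective k R (Q n))
    (d : ∀ n, Q (n + 1) →ₗ[R] Q n) (hd : ∀ n x, d n (d (n + 1) x) = 0)
    (f : Q 0 →ₗ[R] M) (hf : ∀ x, f (d 0 x) = 0) :
    ∃ g : ∀ n, Q n →ₗ[R] T.P n, (∀ x, T.ε (g 0 x) = f x) ∧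
      ∀ n x, T.d n (g (n + 1) x) = g n (d n x) := by
  obtain ⟨s₀, -, hs₀, -⟩ := T.contractible
  obtain ⟨g₀, hg₀⟩ := (hQ 0).exists_lift T.ε s₀ f fun q => hs₀ _
  obtain ⟨g, rfl, hg⟩ := exists_seq_of_step (G := fun n => Q n →ₗ[R] T.P n)
    (fun n g => ∀ x, T.IsCycle n (g (d n x)))
    (fun n g g' => ∀ x, T.d n (g' x) = g (d n x)) g₀
    (fun x => (hg₀ _).trans (hf x)) (fun n g hg => by
      obtain ⟨g', hg'⟩ := T.exists_lift_of_isCycle (hQ (n + 1)) (g ∘ₗ d n) hg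
      refine ⟨g', fun x => ?_, hg'⟩
      change T.d n (g' (d (n + 1) x)) = 0
      rw [hg', LinearMap.comp_apply, hd, map_zero])
  exact ⟨g, hg₀, hg⟩

/-- A chain map from a complex of relatively projective modules to a resolution is
null-homotopic if it becomes zero under the augmentation. -/
theorem exists_chain_homotopy (T : RelProjResolution k R M) {Q : ℕ → Type u}
    [∀ n, AddCommGroup (Q n)] [∀ n, Module k (Q n)] [∀ n, Module R (Q n)]
    [∀ n, IsScalarTower k R (Q n)] (hQ : ∀ n, IsRelProjective k R (Q n))
    (d : ∀ n, Q (n + 1) →ₗ[R] Q n) (hd : ∀ n x, d n (d (n + 1) x) = 0)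
    (g : ∀ n, Q n →ₗ[R] T.P n) (hε : ∀ x, T.ε (g 0 x) = 0)
    (hg : ∀ n x, T.d n (g (n + 1) x) = g n (d n x)) :
    ∃ h : ∀ n, Q n →ₗ[R] T.P (n + 1), (∀ x, T.d 0 (h 0 x) = g 0 x) ∧
      ∀ n x, h n (d n x) + T.d (n + 1) (h (n + 1) x) = g (n + 1) x := by
  obtain ⟨h₀, hh₀⟩ := T.exists_lift_of_isCycle (hQ 0) (g 0) hε
  obtain ⟨h, rfl, hh⟩ := exists_seq_of_step (G := fun n => Q n →ₗ[R] T.P (n + 1))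
    (fun n h => ∀ x, T.d n (h (d n x)) = g n (d n x))
    (fun n h h' => ∀ x, h (d n x) + T.d (n + 1) (h' x) = g (n + 1) x) h₀
    (fun x => hh₀ _) (fun n h hn => by
      obtain ⟨h', hh'⟩ := T.exists_lift_of_isCycle (hQ (n + 1)) (g (n + 1) - h ∘ₗ d n) (fun x => by
        change T.d n (g (n + 1) x - h (d n x)) = 0
        rw [map_sub, hg, hn, sub_self])
      refine ⟨h', fun x => ?_, fun x => ?_⟩
      · rw [hh', LinearMap.sub_apply, LinearMap.comp_apply, hd, map_zero, sub_zero]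
      · rw [hh', LinearMap.sub_apply, LinearMap.comp_apply, add_sub_cancel])
  exact ⟨h, hh₀, hh⟩

end RelProjResolution

section Balanced

variable {k R : Type u} [CommRing k] [Ring R] [Algebra k R]
  {N : Type u} [AddCommGroup N] [Module k N] [Module Rᵐᵒᵖ N] [IsScalarTower k Rᵐᵒᵖ N]
  {Q Q' Q'' : Type u} [AddCommGroup Q] [Module k Q] [Module R Q] [IsScalarTower k R Q]
  [AddCommGroup Q'] [Module k Q'] [Module R Q'] [IsScalarTower k R Q']
  [AddCommGroup Q''] [Module k Q''] [Module R Q''] [IsScalarTower k R Q'']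

variable (k R N Q) in
/-- The class of `n ⊗ q` in `N ⊗_R Q`, as a bilinear map. -/
def balancedMk : N →ₗ[k] Q →ₗ[k] BalancedTensor k R N Q :=
  (TensorProduct.mk k N Q).compr₂ (balancedSubmodule k R N Q).mkQ

theorem balancedMk_smul (n : N) (r : R) (q : Q) :
    balancedMk k R N Q n (r • q) = balancedMk k R N Q (op r • n) q :=
  ((Submodule.Quotient.eq (balancedSubmodule k R N Q)).2
    (Submodule.subset_span ⟨n, r, q, rfl⟩)).symm

theorem balanced_hom_ext {W : Type u} [AddCommGroup W] [Module k W]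
    {f g : BalancedTensor k R N Q →ₗ[k] W}
    (h : ∀ n q, f (balancedMk k R N Q n q) = g (balancedMk k R N Q n q)) : f = g :=
  Submodule.linearMap_qext _ (TensorProduct.ext' h)

/-- The linear map on `N ⊗_R Q` induced by a balanced bilinear map. -/
def balancedLift {W : Type u} [AddCommGroup W] [Module k W] (f : N →ₗ[k] Q →ₗ[k] W)
    (hf : ∀ n (r : R) q, f (op r • n) q = f n (r • q)) : BalancedTensor k R N Q →ₗ[k] W :=
  (balancedSubmodule k R N Q).liftQ (TensorProduct.lift f) (by
    rw [balancedSubmodule, Submodule.span_le]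
    rintro _ ⟨n, r, q, rfl⟩
    simp [hf])

@[simp]
theorem balancedLift_mk {W : Type u} [AddCommGroup W] [Module k W] (f : N →ₗ[k] Q →ₗ[k] W)
    (hf : ∀ n (r : R) q, f (op r • n) q = f n (r • q)) (n : N) (q : Q) :
    balancedLift f hf (balancedMk k R N Q n q) = f n q := rfl

@[simp]
theorem balancedMap_mk (f : Q →ₗ[R] Q') (n : N) (q : Q) :
    balancedMap k N f (balancedMk k R N Q n q) = balancedMk k R N Q' n (f q) := rfl

theorem balancedMap_comp (f : Q →ₗ[R] Q') (g : Q' →ₗ[R] Q'') :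
    balancedMap k N (g ∘ₗ f) = balancedMap k N g ∘ₗ balancedMap k N f :=
  balanced_hom_ext fun _ _ => rfl

theorem balancedMap_id : balancedMap k N (LinearMap.id : Q →ₗ[R] Q) = LinearMap.id :=
  balanced_hom_ext fun _ _ => rfl

theorem balancedMap_zero : balancedMap k N (0 : Q →ₗ[R] Q') = 0 :=
  balanced_hom_ext fun n q => by simp

end Balanced

section RelTorMaps

open CategoryTheory

variable {k R : Type u} [CommRing k] [Ring R] [Algebra k R]
  {M M' : Type u} [AddCommGroup M] [Module k M] [Module R M] [IsScalarTower k R M]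
  [AddCommGroup M'] [Module k M'] [Module R M'] [IsScalarTower k R M']
  (N : Type u) [AddCommGroup N] [Module k N] [Module Rᵐᵒᵖ N] [IsScalarTower k Rᵐᵒᵖ N]

theorem relTorComplex_d (P : RelProjResolution k R M) (n : ℕ) :
    (relTorComplex N P).d (n + 1) n = ModuleCat.ofHom (balancedMap k N (P.d n)) :=
  ChainComplex.of_d (fun n => ModuleCat.of k (BalancedTensor k R N (P.P n)))
    (fun n => ModuleCat.ofHom (balancedMap k N (P.d n))) n

/-- The map of complexes `N ⊗_R f`. -/
def relTorMap {P : RelProjResolution k R M} {P' : RelProjResolution k R M'}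
    (f : ∀ n, P.P n →ₗ[R] P'.P n) (hf : ∀ n x, P'.d n (f (n + 1) x) = f n (P.d n x)) :
    relTorComplex N P ⟶ relTorComplex N P' :=
  ChainComplex.ofHom (fun n => ModuleCat.ofHom (balancedMap k N (f n))) fun n => by
    rw [relTorComplex_d, relTorComplex_d]
    refine ModuleCat.hom_ext (balanced_hom_ext fun m q => ?_)
    exact congrArg (balancedMk k R N _ m) (hf n q)

/-- An endomorphism of a resolution that lifts the identity is homotopic to the identity. -/
theorem exists_homotopy_relTorMap_comp {P : RelProjResolution k R M} {Q : RelProjResolution k R M}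
    (f : ∀ n, P.P n →ₗ[R] Q.P n) (hf : ∀ n x, Q.d n (f (n + 1) x) = f n (P.d n x))
    (hf0 : ∀ x, Q.ε (f 0 x) = P.ε x)
    (g : ∀ n, Q.P n →ₗ[R] P.P n) (hg : ∀ n x, P.d n (g (n + 1) x) = g n (Q.d n x))
    (hg0 : ∀ x, P.ε (g 0 x) = Q.ε x) :
    Nonempty (Homotopy (relTorMap N f hf ≫ relTorMap N g hg) (𝟙 _)) := by
  obtain ⟨h, hh0, hh⟩ := P.exists_chain_homotopy P.relProjective P.d P.d_d
    (fun n => g n ∘ₗ f n - LinearMap.id)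
    (fun x => by simp [hg0, hf0]) (fun n x => by simp [hg, hf])
  refine exists_homotopy_of_family _ _ (fun n => ModuleCat.ofHom (balancedMap k N (h n))) ?_
    fun n => ?_
  · rw [relTorComplex_d]
    refine ModuleCat.hom_ext (balanced_hom_ext fun n q => ?_)
    change balancedMk k R N _ n (g 0 (f 0 q)) - balancedMk k R N _ n q =
      balancedMk k R N _ n (P.d 0 (h 0 q))
    rw [hh0, ← map_sub]
    rfl
  · rw [relTorComplex_d, relTorComplex_d]
    refine ModuleCat.hom_ext (balanced_hom_ext fun m q => ?_)
    change balancedMk k R N _ m (g (n + 1) (f (n + 1) q)) - balancedMk k R N _ m q =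
      balancedMk k R N _ m (h n (P.d n q)) + balancedMk k R N _ m (P.d (n + 1) (h (n + 1) q))
    rw [← map_add, hh, ← map_sub]
    rfl

/-- Relative Tor does not depend on the resolution. -/
theorem exists_relTor_linearEquiv (P Q : RelProjResolution k R M) (n : ℕ) :
    Nonempty (RelTor N P n ≃ₗ[k] RelTor N Q n) := by
  obtain ⟨f, hf0, hf⟩ := Q.exists_chain_lift P.relProjective P.d P.d_d P.ε P.ε_d
  obtain ⟨g, hg0, hg⟩ := P.exists_chain_lift Q.relProjective Q.d Q.d_d Q.ε Q.ε_d
  exact exists_homology_linearEquiv (relTorMap N f hf) (relTorMap N g hg)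
    (exists_homotopy_relTorMap_comp N f hf hf0 g hg hg0)
    (exists_homotopy_relTorMap_comp N g hg hg0 f hf hf0) n

/-- An isomorphism between complexes of modules given degreewise. -/
theorem exists_homology_linearEquiv_of_equiv {K L : ChainComplex (ModuleCat.{u} k) ℕ}
    (e : ∀ n, K.X n ≃ₗ[k] L.X n)
    (he : ∀ n x, (L.d (n + 1) n).hom (e (n + 1) x) = e n ((K.d (n + 1) n).hom x)) (n : ℕ) :
    Nonempty (K.homology n ≃ₗ[k] L.homology n) := by
  let i : K ≅ L := HomologicalComplex.Hom.isoOfComponents (fun n => (e n).toModuleIso) (by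
    rintro i j rfl
    ext x
    exact he j x)
  exact ⟨((HomologicalComplex.homologyFunctor _ _ n).mapIso i).toLinearEquiv⟩

end RelTorMaps

namespace RelProjResolution

variable {k R : Type u} [CommRing k] [Ring R] [Algebra k R]
  {M M' M'' : Type u} [AddCommGroup M] [Module k M] [Module R M] [IsScalarTower k R M]
  [AddCommGroup M'] [Module k M'] [Module R M'] [IsScalarTower k R M']
  [AddCommGroup M''] [Module k M''] [Module R M''] [IsScalarTower k R M'']

/-- The direct sum of two resolutions. -/
def prod (P : RelProjResolution k R M) (P' : RelProjResolution k R M') :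
    RelProjResolution k R (M × M') where
  P n := P.P n × P'.P n
  d n := (P.d n).prodMap (P'.d n)
  ε := P.ε.prodMap P'.ε
  d_d n x := by simp [P.d_d, P'.d_d]
  ε_d x := by simp [P.ε_d, P'.ε_d]
  relProjective n := (P.relProjective n).prod (P'.relProjective n)
  contractible := by
    obtain ⟨s₀, s, h1, h2, h3⟩ := P.contractible
    obtain ⟨s₀', s', h1', h2', h3'⟩ := P'.contractible
    exact ⟨s₀.prodMap s₀', fun n => (s n).prodMap (s' n),
      fun m => Prod.ext (h1 _) (h1' _), fun m => Prod.ext (h2 _) (h2' _),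
      fun n m => Prod.ext (h3 n _) (h3' n _)⟩

/-- The resolution of an extension `0 → M' → M → M'' → 0` built from resolutions of `M'` and
`M''` and a twisting map `θ`. -/
def horseshoe (P : RelProjResolution k R M') (Q : RelProjResolution k R M'')
    (i : M' →ₗ[R] M) (p : M →ₗ[R] M'') (r : M →ₗ[k] M') (hip : ∀ x, p (i x) = 0)
    (hri : ∀ x, r (i x) = x) (hir : ∀ y, p y = 0 → i (r y) = y)
    (t : Q.P 0 →ₗ[R] M) (ht : ∀ q, p (t q) = Q.ε q)
    (θ : ∀ n, Q.P (n + 1) →ₗ[R] P.P n) (hθ0 : ∀ q, i (P.ε (θ 0 q)) = - t (Q.d 0 q))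
    (hθ : ∀ n q, P.d n (θ (n + 1) q) = - θ n (Q.d (n + 1) q)) :
    RelProjResolution k R M where
  P n := P.P n × Q.P n
  d n := ((P.d n).coprod (θ n)).prod (Q.d n ∘ₗ LinearMap.snd R _ _)
  ε := (i ∘ₗ P.ε).coprod t
  d_d n x := by
    ext <;> simp [P.d_d, Q.d_d, hθ]
  ε_d x := by simp [P.ε_d, hθ0]
  relProjective n := (P.relProjective n).prod (Q.relProjective n)
  contractible := by
    obtain ⟨s₀, s, h1, h2, h3⟩ := P.contractible
    obtain ⟨s₀', s', h1', h2', h3'⟩ := Q.contractible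
    let T : ∀ n, Q.P (n + 1) →ₗ[k] P.P n := fun n => (θ n).restrictScalars k
    let pk : M →ₗ[k] M'' := p.restrictScalars k
    let tk : Q.P 0 →ₗ[k] M := t.restrictScalars k
    refine ⟨(s₀ ∘ₗ r ∘ₗ (LinearMap.id - tk ∘ₗ s₀' ∘ₗ pk)).prod (s₀' ∘ₗ pk),
      fun n => ((s n).coprod (- (s n ∘ₗ T n ∘ₗ s' n))).prod (s' n ∘ₗ LinearMap.snd k _ _),
      fun m => ?_, fun x => ?_, fun n x => ?_⟩
    · have h : p (m - t (s₀' (p m))) = 0 := by rw [map_sub, ht, h1', sub_self]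
      change i (P.ε (s₀ (r (m - t (s₀' (p m)))))) + t (s₀' (p m)) = m
      rw [h1, hir _ h, sub_add_cancel]
    · obtain ⟨x, q⟩ := x
      have hp : p (i (P.ε x) + t q) = Q.ε q := by rw [map_add, hip, ht, zero_add]
      refine Prod.ext ?_ ?_
      · change P.d 0 (s 0 x + - s 0 (θ 0 (s' 0 q))) + θ 0 (s' 0 q) +
          s₀ (r (i (P.ε x) + t q - t (s₀' (p (i (P.ε x) + t q))))) = x
        have e1 : t q - t (s₀' (Q.ε q)) = i (- P.ε (θ 0 (s' 0 q))) := by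
          rw [map_neg, hθ0, neg_neg, ← map_sub, sub_eq_of_eq_add (h2' q).symm]
        rw [hp, add_sub_assoc, e1, ← map_add, hri]
        simp only [map_add, map_neg]
        linear_combination (norm := abel) h2 x - h2 (θ 0 (s' 0 q))
      · change Q.d 0 (s' 0 q) + s₀' (p (i (P.ε x) + t q)) = q
        rw [hp, h2']
    · obtain ⟨x, q⟩ := x
      refine Prod.ext ?_ (h3' n q)
      change P.d (n + 1) (s (n + 1) x + - s (n + 1) (θ (n + 1) (s' (n + 1) q))) +
          θ (n + 1) (s' (n + 1) q) +
          (s n (P.d n x + θ n q) + - s n (θ n (s' n (Q.d n q)))) = x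
      have e1 : θ n q - θ n (s' n (Q.d n q)) = - P.d n (θ (n + 1) (s' (n + 1) q)) := by
        rw [hθ, neg_neg, ← map_sub, sub_eq_of_eq_add (h3' n q).symm]
      have e2 := congrArg (s n) e1
      simp only [map_sub, map_neg, map_add] at e2 ⊢
      linear_combination (norm := abel) h3 n x - h3 n (θ (n + 1) (s' (n + 1) q)) + e2

end RelProjResolution

section LongExact

open CategoryTheory

variable {k R : Type u} [CommRing k] [Ring R] [Algebra k R]
  {M M' M'' : Type u} [AddCommGroup M] [Module k M] [Module R M] [IsScalarTower k R M]
  [AddCommGroup M'] [Module k M'] [Module R M'] [IsScalarTower k R M']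
  [AddCommGroup M''] [Module k M''] [Module R M''] [IsScalarTower k R M'']
  (N : Type u) [AddCommGroup N] [Module k N] [Module Rᵐᵒᵖ N] [IsScalarTower k Rᵐᵒᵖ N]

/-- Exactness of a sequence of three families of maps is invariant under isomorphisms. -/
theorem exists_exact_sequence_of_equiv {A B C A' B' C' : ℕ → Type u}
    [∀ n, AddCommGroup (A n)] [∀ n, Module k (A n)] [∀ n, AddCommGroup (B n)]
    [∀ n, Module k (B n)] [∀ n, AddCommGroup (C n)] [∀ n, Module k (C n)]
    [∀ n, AddCommGroup (A' n)] [∀ n, Module k (A' n)] [∀ n, AddCommGroup (B' n)]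
    [∀ n, Module k (B' n)] [∀ n, AddCommGroup (C' n)] [∀ n, Module k (C' n)]
    (a : ∀ n, A n ≃ₗ[k] A' n) (b : ∀ n, B n ≃ₗ[k] B' n) (c : ∀ n, C n ≃ₗ[k] C' n)
    (H : ∃ (f : ∀ n, A n →ₗ[k] B n) (g : ∀ n, B n →ₗ[k] C n) (δ : ∀ n, C (n + 1) →ₗ[k] A n),
      (∀ n, Function.Exact (f n) (g n)) ∧ (∀ n, Function.Exact (g (n + 1)) (δ n)) ∧
      (∀ n, Function.Exact (δ n) (f n)) ∧ Function.Surjective (g 0)) :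
    ∃ (f : ∀ n, A' n →ₗ[k] B' n) (g : ∀ n, B' n →ₗ[k] C' n) (δ : ∀ n, C' (n + 1) →ₗ[k] A' n),
      (∀ n, Function.Exact (f n) (g n)) ∧ (∀ n, Function.Exact (g (n + 1)) (δ n)) ∧
      (∀ n, Function.Exact (δ n) (f n)) ∧ Function.Surjective (g 0) := by
  obtain ⟨f, g, δ, h1, h2, h3, h4⟩ := H
  have key : ∀ {U V W U' V' W' : Type u} [AddCommGroup U] [Module k U] [AddCommGroup V]
      [Module k V] [AddCommGroup W] [Module k W] [AddCommGroup U'] [Module k U']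
      [AddCommGroup V'] [Module k V'] [AddCommGroup W'] [Module k W'] (u : U ≃ₗ[k] U')
      (v : V ≃ₗ[k] V') (w : W ≃ₗ[k] W') (x : U →ₗ[k] V) (y : V →ₗ[k] W),
      Function.Exact x y → Function.Exact (v.toLinearMap ∘ₗ x ∘ₗ u.symm.toLinearMap)
        (w.toLinearMap ∘ₗ y ∘ₗ v.symm.toLinearMap) := by
    intro U V W U' V' W' _ _ _ _ _ _ _ _ _ _ _ _ u v w x y h z
    simp only [LinearMap.comp_apply, LinearEquiv.coe_coe, map_eq_zero_iff w w.injective,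
      h (v.symm z), Set.mem_range]
    constructor
    · rintro ⟨t, ht⟩
      exact ⟨u t, by simp [ht]⟩
    · rintro ⟨t, ht⟩
      exact ⟨u.symm t, by simp [← ht]⟩
  refine ⟨fun n => (b n).toLinearMap ∘ₗ f n ∘ₗ (a n).symm.toLinearMap,
    fun n => (c n).toLinearMap ∘ₗ g n ∘ₗ (b n).symm.toLinearMap,
    fun n => (a n).toLinearMap ∘ₗ δ n ∘ₗ (c (n + 1)).symm.toLinearMap,
    fun n => key _ _ _ _ _ (h1 n), fun n => key _ _ _ _ _ (h2 n), fun n => key _ _ _ _ _ (h3 n), ?_⟩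
  exact (c 0).surjective.comp (h4.comp (b 0).symm.surjective)

section Product

variable (Q Q' : Type u) [AddCommGroup Q] [Module k Q] [Module R Q] [IsScalarTower k R Q]
  [AddCommGroup Q'] [Module k Q'] [Module R Q'] [IsScalarTower k R Q']

theorem balancedMap_inl_injective :
    Function.Injective (balancedMap k N (LinearMap.inl R Q Q')) := by
  refine Function.LeftInverse.injective (g := balancedMap k N (LinearMap.fst R Q Q')) fun x => ?_
  rw [← LinearMap.comp_apply, ← balancedMap_comp, LinearMap.fst_comp_inl, balancedMap_id,
    LinearMap.id_apply]

theorem balancedMap_snd_surjective :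
    Function.Surjective (balancedMap k N (LinearMap.snd R Q Q')) := by
  refine Function.RightInverse.surjective (g := balancedMap k N (LinearMap.inr R Q Q')) fun x => ?_
  rw [← LinearMap.comp_apply, ← balancedMap_comp, LinearMap.snd_comp_inr, balancedMap_id,
    LinearMap.id_apply]

theorem balancedMap_inl_snd_exact :
    Function.Exact (balancedMap k N (LinearMap.inl R Q Q'))
      (balancedMap k N (LinearMap.snd R Q Q')) := by
  have h : balancedMap k N (LinearMap.inl R Q Q') ∘ₗ balancedMap k N (LinearMap.fst R Q Q') +
      balancedMap k N (LinearMap.inr R Q Q') ∘ₗ balancedMap k N (LinearMap.snd R Q Q') =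
      LinearMap.id := balanced_hom_ext fun m q => by simp [← map_add]
  intro y
  constructor
  · intro hy
    refine ⟨balancedMap k N (LinearMap.fst R Q Q') y, ?_⟩
    simpa [hy] using LinearMap.congr_fun h y
  · rintro ⟨x, rfl⟩
    rw [← LinearMap.comp_apply, ← balancedMap_comp, LinearMap.snd_comp_inl, balancedMap_zero,
      LinearMap.zero_apply]

end Product

/-- The long exact sequence of relative Tor groups of a short exact sequence of modules that
splits over the base ring. -/
theorem exists_relTor_exact_sequence (P : RelProjResolution k R M') (T : RelProjResolution k R M)
    (Q : RelProjResolution k R M'') (i : M' →ₗ[R] M) (p : M →ₗ[R] M'') (r : M →ₗ[k] M')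
    (s : M'' →ₗ[k] M) (hip : ∀ x, p (i x) = 0) (hri : ∀ x, r (i x) = x)
    (hps : ∀ z, p (s z) = z) (hir : ∀ y, p y = 0 → i (r y) = y) :
    ∃ (f : ∀ n, RelTor N P n →ₗ[k] RelTor N T n) (g : ∀ n, RelTor N T n →ₗ[k] RelTor N Q n)
      (δ : ∀ n, RelTor N Q (n + 1) →ₗ[k] RelTor N P n),
      (∀ n, Function.Exact (f n) (g n)) ∧ (∀ n, Function.Exact (g (n + 1)) (δ n)) ∧
      (∀ n, Function.Exact (δ n) (f n)) ∧ Function.Surjective (g 0) := by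
  obtain ⟨t, ht⟩ := (Q.relProjective 0).exists_lift p s Q.ε fun q => hps _
  have hi : Function.Injective i := Function.LeftInverse.injective hri
  have hpt : ∀ q, p (t (Q.d 0 q)) = 0 := fun q => by rw [ht, Q.ε_d]
  let u : Q.P 1 →ₗ[R] M' :=
    { toFun := fun q => - r (t (Q.d 0 q))
      map_add' := fun x y => by simp only [map_add]; abel
      map_smul' := fun c x => hi (by
        simp only [RingHom.id_apply, map_smul, map_neg]
        rw [hir _ (hpt x), hir _ (by rw [map_smul, hpt, smul_zero]), smul_neg]) }
  have hu : ∀ q, i (u q) = - t (Q.d 0 q) := fun q => by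
    change i (- r (t (Q.d 0 q))) = _
    rw [map_neg, hir _ (hpt q)]
  obtain ⟨θ, hθ0, hθ⟩ := P.exists_chain_lift (Q := fun n => Q.P (n + 1))
    (fun n => Q.relProjective (n + 1)) (fun n => - Q.d (n + 1))
    (fun n x => by simp [Q.d_d]) u (fun x => hi (by simp [hu, Q.d_d]))
  let H := P.horseshoe Q i p r hip hri hir t ht θ (fun q => by rw [hθ0, hu])
    (fun n q => by rw [hθ, LinearMap.neg_apply, map_neg])
  let e := fun n => (exists_relTor_linearEquiv N H T n).some
  refine exists_exact_sequence_of_equiv (fun n => LinearEquiv.refl k _) e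
    (fun n => LinearEquiv.refl k _) ?_
  refine exists_exact_homology_sequence
    (relTorMap N (P := P) (P' := H) (fun n => LinearMap.inl R (P.P n) (Q.P n)) fun n x => ?_)
    (relTorMap N (P := H) (P' := Q) (fun n => LinearMap.snd R (P.P n) (Q.P n)) fun n x => rfl)
    (fun n => ?_) (fun n => ?_) (fun n => ?_)
  · change (P.d n x + θ n 0, Q.d n 0) = (P.d n x, 0)
    rw [map_zero, map_zero, add_zero]
  · exact balancedMap_inl_injective N (P.P n) (Q.P n)
  · exact balancedMap_snd_surjective N (P.P n) (Q.P n)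
  · exact balancedMap_inl_snd_exact N (P.P n) (Q.P n)

/-- Relative Tor of a direct sum. -/
theorem exists_relTor_prod_linearEquiv (P : RelProjResolution k R M) (P' : RelProjResolution k R M')
    (n : ℕ) : Nonempty (RelTor N (P.prod P') n ≃ₗ[k] RelTor N P n × RelTor N P' n) := by
  let i := relTorMap N (P := P) (P' := P.prod P') (fun n => LinearMap.inl R (P.P n) (P'.P n))
    (fun n x => Prod.ext rfl (map_zero (P'.d n)))
  let i' := relTorMap N (P := P') (P' := P.prod P') (fun n => LinearMap.inr R (P.P n) (P'.P n))
    (fun n x => Prod.ext (map_zero (P.d n)) rfl)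
  let p := relTorMap N (P := P.prod P') (P' := P) (fun n => LinearMap.fst R (P.P n) (P'.P n))
    (fun n x => rfl)
  let p' := relTorMap N (P := P.prod P') (P' := P') (fun n => LinearMap.snd R (P.P n) (P'.P n))
    (fun n x => rfl)
  have e1 : i ≫ p = 𝟙 _ := by
    ext1 n
    exact ModuleCat.hom_ext (balanced_hom_ext fun m q => rfl)
  have e2 : i' ≫ p' = 𝟙 _ := by
    ext1 n
    exact ModuleCat.hom_ext (balanced_hom_ext fun m q => rfl)
  have e3 : i ≫ p' = 0 := by
    ext1 n
    exact ModuleCat.hom_ext (balanced_hom_ext fun m q => map_zero (balancedMk k R N _ m))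
  have e4 : i' ≫ p = 0 := by
    ext1 n
    exact ModuleCat.hom_ext (balanced_hom_ext fun m q => map_zero (balancedMk k R N _ m))
  have e5 : p ≫ i + p' ≫ i' = 𝟙 _ := by
    ext1 n
    refine ModuleCat.hom_ext (balanced_hom_ext fun m q => ?_)
    change balancedMk k R N (P.P n × P'.P n) m (q.1, 0) +
      balancedMk k R N (P.P n × P'.P n) m (0, q.2) = balancedMk k R N (P.P n × P'.P n) m q
    rw [← map_add, Prod.mk_add_mk, add_zero, zero_add]
    rfl
  let h : ∀ {K L : ChainComplex (ModuleCat.{u} k) ℕ} (f : K ⟶ L), K.homology n →ₗ[k] L.homology n :=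
    fun f => (HomologicalComplex.homologyMap f n).hom
  have hcomp : ∀ {K L L' : ChainComplex (ModuleCat.{u} k) ℕ} (f : K ⟶ L) (g : L ⟶ L') x,
      h g (h f x) = h (f ≫ g) x := fun f g x => by
    simp only [h, HomologicalComplex.homologyMap_comp]
    rfl
  have hid : ∀ {K : ChainComplex (ModuleCat.{u} k) ℕ} x, h (𝟙 K) x = x := fun x => by
    simp only [h, HomologicalComplex.homologyMap_id]
    rfl
  have hzero : ∀ {K L : ChainComplex (ModuleCat.{u} k) ℕ} x, h (0 : K ⟶ L) x = 0 := fun x => by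
    simp only [h, HomologicalComplex.homologyMap_zero]
    rfl
  have hadd : ∀ {K L : ChainComplex (ModuleCat.{u} k) ℕ} (f g : K ⟶ L) x,
      h (f + g) x = h f x + h g x := fun f g x => by
    simp only [h, HomologicalComplex.homologyMap_add]
    rfl
  refine ⟨LinearEquiv.ofLinearMap ((h p).prod (h p')) ((h i).coprod (h i')) ?_ ?_⟩
  · refine LinearMap.ext fun x => Prod.ext ?_ ?_
    · change h p (h i x.1 + h i' x.2) = x.1
      rw [map_add, hcomp, hcomp, e1, e4, hid, hzero, add_zero]
    · change h p' (h i x.1 + h i' x.2) = x.2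
      rw [map_add, hcomp, hcomp, e2, e3, hid, hzero, zero_add]
  · refine LinearMap.ext fun x => ?_
    change h i (h p x) + h i' (h p' x) = x
    rw [hcomp, hcomp, ← hadd, e5, hid]

end LongExact

section Restrict

variable {k R R' : Type u} [CommRing k] [Ring R] [Algebra k R] [Ring R'] [Algebra k R']
  (π : R →ₐ[k] R') (σ : R' →ₗ[k] R) (hσ : ∀ x y, σ (x * y) = σ x * σ y)
  (hπσ : ∀ x, π (σ x) = x) (hσ1 : ∀ r, r * σ 1 = σ (π r))

include hσ hπσ hσ1

/-- Restriction along a surjection `π : R → R'` preserves relative projectivity if `R'` is, via a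
multiplicative section `σ` of `π`, the left ideal of `R` generated by the idempotent `σ 1`. -/
theorem IsRelProjective.restrict {Q : Type u} [AddCommGroup Q] [Module k Q] [Module R' Q]
    [IsScalarTower k R' Q] [Module R Q] [IsScalarTower k R Q]
    (hRQ : ∀ (r : R) (q : Q), r • q = π r • q) (hQ : IsRelProjective k R' Q) : IsRelProjective k R Q := by
  intro Y Z _ _ _ _ _ _ _ _ g s hs h
  obtain ⟨l, hl⟩ := hQ.exists_section
  let Φ : R' ⊗[k] Q →ₗ[k] Y := TensorProduct.lift
    ((((Algebra.lsmul k k Y : R →ₐ[k] Module.End k Y).toLinearMap ∘ₗ σ)).compl₂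
      (s ∘ₗ h.restrictScalars k))
  have hΦ : ∀ r' q, Φ (r' ⊗ₜ q) = σ r' • s (h q) := fun r' q => rfl
  have hΦs : ∀ (r : R) t, Φ (π r • t) = r • Φ t := fun r t => by
    induction t with
    | zero => simp
    | add x y hx hy => rw [smul_add, map_add, hx, hy, map_add, smul_add]
    | tmul r' q =>
      rw [TensorProduct.smul_tmul', hΦ, hΦ, smul_eq_mul, hσ, ← hσ1, mul_assoc, ← hσ, one_mul,
        mul_smul]
  have hgΦ : ∀ t, g (Φ t) = h (actionMap k R' Q t) := fun t => by
    induction t with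
    | zero => simp
    | add x y hx hy => simp only [map_add, hx, hy]
    | tmul r' q => rw [hΦ, map_smul, hs, ← map_smul, hRQ, hπσ, actionMap_tmul]
  refine ⟨{ Φ ∘ₗ l.restrictScalars k with map_smul' := fun r q => ?_ }, fun q => ?_⟩
  · change Φ (l (r • q)) = r • Φ (l q)
    rw [hRQ, map_smul, hΦs]
  · change g (Φ (l q)) = h q
    rw [hgΦ, hl]

/-- Restriction of a resolution along `π`. -/
def RelProjResolution.restrict {M : Type u} [AddCommGroup M] [Module k M] [Module R' M]
    [IsScalarTower k R' M] [Module R M] [IsScalarTower k R M]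
    (hRM : ∀ (r : R) (m : M), r • m = π r • m) (P : RelProjResolution k R' M) :
    RelProjResolution k R M :=
  letI : ∀ n, Module R (P.P n) := fun n => Module.compHom (P.P n) π.toRingHom
  haveI : ∀ n, IsScalarTower k R (P.P n) := fun n => ⟨fun c r x => by
    change π (c • r) • x = c • π r • x
    rw [map_smul, smul_assoc]⟩
  { P := P.P
    d := fun n => { P.d n with map_smul' := fun r x => (P.d n).map_smul (π r) x }
    ε := { P.ε with map_smul' := fun r x => (P.ε.map_smul (π r) x).trans (hRM _ _).symm }
    d_d := P.d_d
    ε_d := P.ε_d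
    relProjective := fun n =>
      IsRelProjective.restrict π σ hσ hπσ hσ1 (fun _ _ => rfl) (P.relProjective n)
    contractible := P.contractible }

/-- Base change along `π` for the tensor product with a right `R`-module `X`: if `N` is the right
`R'`-module `X (σ 1)`, then `X ⊗_R Q = N ⊗_{R'} Q`. -/
def balancedRestrictEquiv {X N Q : Type u} [AddCommGroup X] [Module k X] [Module Rᵐᵒᵖ X]
    [IsScalarTower k Rᵐᵒᵖ X] [AddCommGroup N] [Module k N] [Module R'ᵐᵒᵖ N]
    [IsScalarTower k R'ᵐᵒᵖ N]
    (j : N →ₗ[k] X) (hj : Function.Injective j) (p : X →ₗ[k] N)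
    (hjp : ∀ x, j (p x) = op (σ 1) • x)
    (hjs : ∀ (r : R') n, j (op r • n) = op (σ r) • j n)
    [AddCommGroup Q] [Module k Q] [Module R' Q]
    [IsScalarTower k R' Q] [Module R Q] [IsScalarTower k R Q]
    (hRQ : ∀ (r : R) (q : Q), r • q = π r • q) :
    BalancedTensor k R X Q ≃ₗ[k] BalancedTensor k R' N Q :=
  have h1 : ∀ n, p (j n) = n := fun n => hj (by rw [hjp, ← hjs, op_one, one_smul])
  LinearEquiv.ofLinearMap
    (balancedLift ((balancedMk k R' N Q) ∘ₗ p) fun x r q => by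
      rw [LinearMap.comp_apply, LinearMap.comp_apply, hRQ, balancedMk_smul]
      congr 2
      apply hj
      rw [hjp, hjs, hjp, ← mul_smul, ← mul_smul, ← op_mul, ← op_mul, hσ1, ← hσ, one_mul])
    (balancedLift ((balancedMk k R X Q) ∘ₗ j) fun n r q => by
      rw [LinearMap.comp_apply, LinearMap.comp_apply, hjs, ← balancedMk_smul, hRQ, hπσ])
    (balanced_hom_ext fun n q => by simp [h1])
    (balanced_hom_ext fun x q => by
      simp only [LinearMap.comp_apply, balancedLift_mk, LinearMap.id_apply]
      rw [hjp, ← balancedMk_smul, hRQ, hπσ, one_smul])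

theorem exists_relTor_restrict_linearEquiv {X N M : Type u} [AddCommGroup X] [Module k X]
    [Module Rᵐᵒᵖ X] [IsScalarTower k Rᵐᵒᵖ X] [AddCommGroup N] [Module k N] [Module R'ᵐᵒᵖ N]
    [IsScalarTower k R'ᵐᵒᵖ N]
    (j : N →ₗ[k] X) (hj : Function.Injective j) (p : X →ₗ[k] N)
    (hjp : ∀ x, j (p x) = op (σ 1) • x)
    (hjs : ∀ (r : R') n, j (op r • n) = op (σ r) • j n)
    [AddCommGroup M] [Module k M] [Module R' M] [IsScalarTower k R' M] [Module R M]
    [IsScalarTower k R M] (hRM : ∀ (r : R) (m : M), r • m = π r • m)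
    (P : RelProjResolution k R' M) (n : ℕ) :
    Nonempty (RelTor X (P.restrict π σ hσ hπσ hσ1 hRM) n ≃ₗ[k] RelTor N P n) := by
  let T := P.restrict π σ hσ hπσ hσ1 hRM
  let _ : ∀ n, Module R (P.P n) := fun n => T.module n
  have _ : ∀ n, IsScalarTower k R (P.P n) := fun n => T.isScalarTower n
  refine exists_homology_linearEquiv_of_equiv (K := relTorComplex X T) (L := relTorComplex N P)
    (fun n => balancedRestrictEquiv (Q := P.P n) π σ hσ hπσ hσ1 j hj p hjp hjs fun _ _ => rfl)
    (fun n x => ?_) n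
  rw [relTorComplex_d, relTorComplex_d]
  refine LinearMap.congr_fun (f := balancedMap k N (P.d n) ∘ₗ (balancedRestrictEquiv
      (Q := P.P (n + 1)) π σ hσ hπσ hσ1 j hj p hjp hjs fun _ _ => rfl).toLinearMap)
    (g := (balancedRestrictEquiv (Q := P.P n) π σ hσ hπσ hσ1 j hj p hjp hjs
      fun _ _ => rfl).toLinearMap ∘ₗ balancedMap k X (T.d n)) (balanced_hom_ext fun m q => rfl) x

end Restrict

namespace Hochschild

section Functoriality

variable {k C Y Y' Y'' : Type u} [CommRing k] [Ring C] [Algebra k C]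
  [AddCommGroup Y] [Module k Y] [Module C Y] [Module Cᵐᵒᵖ Y] [SMulCommClass C Cᵐᵒᵖ Y]
  [IsScalarTower k C Y] [IsScalarTower k Cᵐᵒᵖ Y]
  [AddCommGroup Y'] [Module k Y'] [Module C Y'] [Module Cᵐᵒᵖ Y'] [SMulCommClass C Cᵐᵒᵖ Y']
  [IsScalarTower k C Y'] [IsScalarTower k Cᵐᵒᵖ Y']
  [AddCommGroup Y''] [Module k Y''] [Module C Y''] [Module Cᵐᵒᵖ Y''] [SMulCommClass C Cᵐᵒᵖ Y'']
  [IsScalarTower k C Y''] [IsScalarTower k Cᵐᵒᵖ Y'']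

variable (k C Y Y') in
/-- The map `y ⊗ c₁ ⊗ ⋯ ⊗ cₙ ↦ f(y) ⊗ c₁ ⊗ ⋯ ⊗ cₙ`, as a linear function of `f`. -/
def chainMap : ∀ n : ℕ, (Y →ₗ[k] Y') →ₗ[k] (chain k C Y n →ₗ[k] chain k C Y' n)
  | 0 => LinearMap.id
  | n + 1 => LinearMap.rTensorHom C ∘ₗ chainMap n

theorem chainMap_tmul {n : ℕ} (f : Y →ₗ[k] Y') (z : chain k C Y n) (c : C) :
    chainMap k C Y Y' (n + 1) f (tmul k C Y z c) = tmul k C Y' (chainMap k C Y Y' n f z) c := rfl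

theorem chainMap_comp {n : ℕ} (f : Y →ₗ[k] Y') (g : Y' →ₗ[k] Y'') (z : chain k C Y n) :
    chainMap k C Y Y'' n (g ∘ₗ f) z = chainMap k C Y' Y'' n g (chainMap k C Y Y' n f z) := by
  induction n with
  | zero => rfl
  | succ n ih =>
    refine LinearMap.congr_fun (f := chainMap k C Y Y'' (n + 1) (g ∘ₗ f))
      (g := chainMap k C Y' Y'' (n + 1) g ∘ₗ chainMap k C Y Y' (n + 1) f)
      (hom_ext fun z c => ?_) z
    rw [LinearMap.comp_apply, chainMap_tmul, chainMap_tmul, chainMap_tmul, ih]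

theorem chainMap_id {n : ℕ} (z : chain k C Y n) : chainMap k C Y Y n LinearMap.id z = z := by
  induction n with
  | zero => rfl
  | succ n ih =>
    refine LinearMap.congr_fun (f := chainMap k C Y Y (n + 1) LinearMap.id)
      (g := LinearMap.id) (hom_ext fun z c => ?_) z
    rw [chainMap_tmul, ih, LinearMap.id_apply]

theorem chainMap_ract {n : ℕ} (f : Y →ₗ[k] Y') (hf : ∀ (c : C) y, f (op c • y) = op c • f y)
    (c : C) (z : chain k C Y n) :
    chainMap k C Y Y' n f (ract k C Y n c z) = ract k C Y' n c (chainMap k C Y Y' n f z) := by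
  cases n with
  | zero => exact hf c z
  | succ n =>
    refine LinearMap.congr_fun (f := chainMap k C Y Y' (n + 1) f ∘ₗ ract k C Y (n + 1) c)
      (g := ract k C Y' (n + 1) c ∘ₗ chainMap k C Y Y' (n + 1) f) (hom_ext fun z d => ?_) z
    rfl

theorem chainMap_lact {n : ℕ} (f : Y →ₗ[k] Y') (hf : ∀ (c : C) y, f (c • y) = c • f y)
    (c : C) (z : chain k C Y n) :
    chainMap k C Y Y' n f (lact k C Y n c z) = lact k C Y' n c (chainMap k C Y Y' n f z) := by
  induction n with
  | zero => exact hf c z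
  | succ n ih =>
    refine LinearMap.congr_fun (f := chainMap k C Y Y' (n + 1) f ∘ₗ lact k C Y (n + 1) c)
      (g := lact k C Y' (n + 1) c ∘ₗ chainMap k C Y Y' (n + 1) f) (hom_ext fun z d => ?_) z
    simp only [LinearMap.comp_apply, lact_tmul, chainMap_tmul, ih]

theorem chainMap_bPrime {n : ℕ} (f : Y →ₗ[k] Y') (hf : ∀ (c : C) y, f (op c • y) = op c • f y)
    (z : chain k C Y (n + 1)) :
    chainMap k C Y Y' n f (bPrime k C Y n z) = bPrime k C Y' n (chainMap k C Y Y' (n + 1) f z) := by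
  induction n with
  | zero =>
    refine LinearMap.congr_fun (f := chainMap k C Y Y' 0 f ∘ₗ bPrime k C Y 0)
      (g := bPrime k C Y' 0 ∘ₗ chainMap k C Y Y' 1 f) (hom_ext fun z d => ?_) z
    simp only [LinearMap.comp_apply, chainMap_tmul, bPrime_zero_tmul, chainMap_ract f hf]
  | succ n ih =>
    refine LinearMap.congr_fun (f := chainMap k C Y Y' (n + 1) f ∘ₗ bPrime k C Y (n + 1))
      (g := bPrime k C Y' (n + 1) ∘ₗ chainMap k C Y Y' (n + 2) f) (hom_ext fun z d => ?_) z
    simp only [LinearMap.comp_apply, chainMap_tmul, bPrime_succ_tmul, map_add, map_smul, ih,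
      chainMap_ract f hf]

theorem chainMap_b {n : ℕ} (f : Y →ₗ[k] Y') (hf : ∀ (c : C) y, f (op c • y) = op c • f y)
    (hf' : ∀ (c : C) y, f (c • y) = c • f y) (z : chain k C Y (n + 1)) :
    chainMap k C Y Y' n f (b k C Y n z) = b k C Y' n (chainMap k C Y Y' (n + 1) f z) := by
  have h : chainMap k C Y Y' n f (cyclicFace k C Y n z) =
      cyclicFace k C Y' n (chainMap k C Y Y' (n + 1) f z) := by
    refine LinearMap.congr_fun (f := chainMap k C Y Y' n f ∘ₗ cyclicFace k C Y n)
      (g := cyclicFace k C Y' n ∘ₗ chainMap k C Y Y' (n + 1) f) (hom_ext fun z d => ?_) z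
    simp only [LinearMap.comp_apply, cyclicFace_tmul, chainMap_tmul, chainMap_lact f hf']
  rw [b_apply, b_apply, map_add, map_smul, chainMap_bPrime f hf, h]

variable (R : Type u) [Ring R] [Algebra k R] [Module R Y] [IsScalarTower k R Y]

variable (k C Y) in
/-- The action of an algebra `R` on the Hochschild chains through the coefficients. -/
def chainAct (n : ℕ) : R →ₐ[k] Module.End k (chain k C Y n) :=
  AlgHom.ofLinearMap
    (chainMap k C Y Y n ∘ₗ (Algebra.lsmul k k Y : R →ₐ[k] Module.End k Y).toLinearMap)
    (LinearMap.ext fun z => by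
      simp only [LinearMap.comp_apply, AlgHom.toLinearMap_apply, map_one]
      exact chainMap_id z)
    (fun r s => LinearMap.ext fun z => by
      simp only [LinearMap.comp_apply, AlgHom.toLinearMap_apply, map_mul]
      exact chainMap_comp _ _ z)

variable (k C Y) in
/-- The `R`-module of Hochschild chains with coefficients in an `R`-module. -/
abbrev chainModule (n : ℕ) : Module R (chain k C Y n) :=
  Module.compHom _ (chainAct k C Y R n).toRingHom

theorem chainModule_isScalarTower (n : ℕ) :
    letI := chainModule k C Y R n
    IsScalarTower k R (chain k C Y n) :=
  letI := chainModule k C Y R n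
  ⟨fun c r z => by
    change chainAct k C Y R n (c • r) z = c • chainAct k C Y R n r z
    rw [map_smul, LinearMap.smul_apply]⟩

theorem isRelProjective_chain (hY : IsRelProjective k R Y) (n : ℕ) :
    letI := chainModule k C Y R n
    IsRelProjective k R (chain k C Y n) := by
  induction n with
  | zero => exact hY
  | succ n ih =>
    let _ := chainModule k C Y R n
    have _ := chainModule_isScalarTower (C := C) (Y := Y) (k := k) R n
    let _ := chainModule k C Y R (n + 1)
    have _ := chainModule_isScalarTower (C := C) (Y := Y) (k := k) R (n + 1)
    exact ih.of_tensor_equiv (Q' := chain k C Y (n + 1))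
      (LinearEquiv.refl k (chain k C Y n ⊗[k] C)) fun r q w => rfl

end Functoriality

end Hochschild

namespace Corner

variable {k S X C D : Type u} [CommRing k] [Ring S] [Algebra k S]
  [AddCommGroup X] [Module k X] [Module S X] [Module Sᵐᵒᵖ X] [SMulCommClass S Sᵐᵒᵖ X]
  [IsScalarTower k S X] [IsScalarTower k Sᵐᵒᵖ X]
  [Ring C] [Algebra k C] [Ring D] [Algebra k D]

variable (X) in
/-- The projection `x ↦ φ(1) x ψ(1)` to the corner. -/
def proj (φ : C →ₙₐ[k] S) (ψ : D →ₙₐ[k] S) : X →ₗ[k] Corner X φ ψ :=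
  LinearMap.rangeRestrict (Algebra.lsmul k k X (φ 1) ∘ₗ Algebra.lsmul k k X (op (ψ 1)))

theorem val_proj (φ : C →ₙₐ[k] S) (ψ : D →ₙₐ[k] S) (x : X) :
    val X φ ψ (proj X φ ψ x) = φ 1 • op (ψ 1) • x := rfl

end Corner

section Inner

variable {k S C : Type u} [CommRing k] [Ring S] [Algebra k S] [Ring C] [Algebra k C]
  (φ : C →ₙₐ[k] S)

/-- The `(S, C)`-bimodule `S φ(1)`. -/
abbrev ColumnCorner : Type u := Corner S (NonUnitalAlgHom.id k S) φ

/-- The `(C, S)`-bimodule `φ(1) S`. -/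
abbrev RowCorner : Type u := Corner S φ (NonUnitalAlgHom.id k S)

/-- The module `Sφ(1) ⊗ φ(1)S`, with the inner `C`-bimodule structure
`c (u ⊗ v) d = u d ⊗ c v` and the outer `S`-bimodule structure. -/
def InnerTensor : Type u := ColumnCorner φ ⊗[k] RowCorner φ

namespace InnerTensor

instance : AddCommGroup (InnerTensor φ) :=
  inferInstanceAs (AddCommGroup (ColumnCorner φ ⊗[k] RowCorner φ))

instance : Module k (InnerTensor φ) :=
  inferInstanceAs (Module k (ColumnCorner φ ⊗[k] RowCorner φ))

/-- The pure tensor `u ⊗ v`. -/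
def tmul (u : ColumnCorner φ) (v : RowCorner φ) : InnerTensor φ := u ⊗ₜ[k] v

variable {φ} in
theorem induction_on {p : InnerTensor φ → Prop} (y : InnerTensor φ) (h0 : p 0)
    (ht : ∀ u v, p (tmul φ u v)) (ha : ∀ x y, p x → p y → p (x + y)) : p y :=
  TensorProduct.induction_on y h0 ht ha

/-- The inner left action of `C`. -/
def innerLeft : C →ₐ[k] Module.End k (InnerTensor φ) :=
  (Module.End.lTensorAlgHom k (RowCorner φ) (ColumnCorner φ)).comp (Algebra.lsmul k k (RowCorner φ))

/-- The inner right action of `C`. -/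
def innerRight : Cᵐᵒᵖ →ₐ[k] Module.End k (InnerTensor φ) :=
  (Module.End.rTensorAlgHom k (ColumnCorner φ) (RowCorner φ)).comp
    (Algebra.lsmul k k (ColumnCorner φ))

/-- The outer left action of `S`. -/
def outerLeft : S →ₐ[k] Module.End k (InnerTensor φ) :=
  (Module.End.rTensorAlgHom k (ColumnCorner φ) (RowCorner φ)).comp
    (Algebra.lsmul k k (ColumnCorner φ))

/-- The outer right action of `S`. -/
def outerRight : Sᵐᵒᵖ →ₐ[k] Module.End k (InnerTensor φ) :=
  (Module.End.lTensorAlgHom k (RowCorner φ) (ColumnCorner φ)).comp (Algebra.lsmul k k (RowCorner φ))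

/-- The outer action of `S ⊗ Sᵒᵖ`. -/
def outer : S ⊗[k] Sᵐᵒᵖ →ₐ[k] Module.End k (InnerTensor φ) :=
  Algebra.TensorProduct.lift (outerLeft φ) (outerRight φ)
    (fun _ _ => TensorProduct.ext' fun _ _ => rfl)

instance : Module C (InnerTensor φ) := Module.compHom _ (innerLeft φ).toRingHom

instance : Module Cᵐᵒᵖ (InnerTensor φ) := Module.compHom _ (innerRight φ).toRingHom

instance : Module (S ⊗[k] Sᵐᵒᵖ) (InnerTensor φ) := Module.compHom _ (outer φ).toRingHom

theorem smul_left (c : C) (u : ColumnCorner φ) (v : RowCorner φ) :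
    c • tmul φ u v = tmul φ u (c • v) := rfl

theorem smul_right (c : Cᵐᵒᵖ) (u : ColumnCorner φ) (v : RowCorner φ) :
    c • tmul φ u v = tmul φ (c • u) v := rfl

theorem smul_outer (s : S) (t : Sᵐᵒᵖ) (u : ColumnCorner φ) (v : RowCorner φ) :
    (s ⊗ₜ[k] t) • tmul φ u v = tmul φ (s • u) (t • v) := rfl

theorem zero_smul_outer (y : InnerTensor φ) : (0 : S ⊗[k] Sᵐᵒᵖ) • y = 0 := by
  change outer φ 0 y = 0
  rw [map_zero, LinearMap.zero_apply]

instance : IsScalarTower k C (InnerTensor φ) :=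
  ⟨fun r c y => by
    change innerLeft φ (r • c) y = r • innerLeft φ c y
    rw [map_smul, LinearMap.smul_apply]⟩

instance : IsScalarTower k Cᵐᵒᵖ (InnerTensor φ) :=
  ⟨fun r c y => by
    change innerRight φ (r • c) y = r • innerRight φ c y
    rw [map_smul, LinearMap.smul_apply]⟩

instance : IsScalarTower k (S ⊗[k] Sᵐᵒᵖ) (InnerTensor φ) :=
  ⟨fun r c y => by
    change outer φ (r • c) y = r • outer φ c y
    rw [map_smul, LinearMap.smul_apply]⟩

instance : SMulCommClass C Cᵐᵒᵖ (InnerTensor φ) :=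
  ⟨fun c d y => by
    induction y using induction_on with
    | h0 => simp only [smul_zero]
    | ht u v => rfl
    | ha x y hx hy => simp only [smul_add, hx, hy]⟩

instance : SMulCommClass (S ⊗[k] Sᵐᵒᵖ) C (InnerTensor φ) :=
  ⟨fun r d y => by
    induction y using induction_on with
    | h0 => simp only [smul_zero]
    | ht u v =>
      induction r with
      | zero => simp only [zero_smul_outer, smul_zero]
      | add r s hr hs => simp only [add_smul, smul_add, hr, hs]
      | tmul s t => rw [smul_left, smul_outer, smul_outer, smul_left, smul_comm d t v]
    | ha x y hx hy => simp only [smul_add, hx, hy]⟩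

instance : SMulCommClass (S ⊗[k] Sᵐᵒᵖ) Cᵐᵒᵖ (InnerTensor φ) :=
  ⟨fun r d y => by
    induction y using induction_on with
    | h0 => simp only [smul_zero]
    | ht u v =>
      induction r with
      | zero => simp only [zero_smul_outer, smul_zero]
      | add r s hr hs => simp only [add_smul, smul_add, hr, hs]
      | tmul s t => rw [smul_right, smul_outer, smul_outer, smul_right, smul_comm]
    | ha x y hx hy => simp only [smul_add, hx, hy]⟩

/-- The element `φ(1)` of `Sφ(1)`. -/
def columnUnit : ColumnCorner φ := Corner.proj S (NonUnitalAlgHom.id k S) φ 1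

/-- The element `φ(1)` of `φ(1)S`. -/
def rowUnit : RowCorner φ := Corner.proj S φ (NonUnitalAlgHom.id k S) 1

theorem val_columnUnit : Corner.val S _ φ (columnUnit φ) = φ 1 := by
  rw [columnUnit, Corner.val_proj]
  simp

theorem val_rowUnit : Corner.val S φ _ (rowUnit φ) = φ 1 := by
  rw [rowUnit, Corner.val_proj]
  simp

/-- The inclusion `u ⊗ v ↦ u ⊗ v` of `Sφ(1) ⊗ φ(1)S` in `S ⊗ Sᵒᵖ`. -/
def toEnv : InnerTensor φ →ₗ[k] S ⊗[k] Sᵐᵒᵖ :=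
  TensorProduct.map (Corner.val S _ φ) ((opLinearEquiv k).toLinearMap ∘ₗ Corner.val S φ _)

theorem toEnv_tmul (u : ColumnCorner φ) (v : RowCorner φ) :
    toEnv φ (tmul φ u v) = Corner.val S _ φ u ⊗ₜ op (Corner.val S φ _ v) := rfl

theorem toEnv_smul (r : S ⊗[k] Sᵐᵒᵖ) (y : InnerTensor φ) : toEnv φ (r • y) = r * toEnv φ y := by
  induction y using induction_on with
  | h0 => simp
  | ht u v =>
    induction r with
    | zero => rw [zero_smul_outer, map_zero, zero_mul]
    | add r s hr hs => simp only [add_smul, map_add, add_mul, hr, hs]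
    | tmul s t =>
      rw [smul_outer, toEnv_tmul, toEnv_tmul, Corner.val_smul_left, Corner.val_smul_right,
        Algebra.TensorProduct.tmul_mul_tmul]
      rfl
  | ha x y hx hy => simp only [smul_add, map_add, mul_add, hx, hy]

/-- The generator `φ(1) ⊗ φ(1)`. -/
def gen : InnerTensor φ := tmul φ (columnUnit φ) (rowUnit φ)

theorem toEnv_smul_gen (y : InnerTensor φ) : toEnv φ y • gen φ = y := by
  induction y using induction_on with
  | h0 => rw [map_zero, zero_smul_outer]
  | ht u v =>
    rw [toEnv_tmul, gen, smul_outer]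
    congr 1
    · apply Corner.val_injective
      rw [Corner.val_smul_left, val_columnUnit]
      exact Corner.right_one u
    · apply Corner.val_injective
      rw [Corner.val_smul_right, val_rowUnit]
      exact Corner.left_one v
  | ha x y hx hy => simp only [map_add, add_smul, hx, hy]

theorem isRelProjective : IsRelProjective k (S ⊗[k] Sᵐᵒᵖ) (InnerTensor φ) := by
  intro Y Z _ _ _ _ _ _ _ _ g s hs h
  refine ⟨{ toFun := fun y => toEnv φ y • s (h (gen φ))
            map_add' := fun x y => by rw [map_add, add_smul]
            map_smul' := fun r y => by rw [toEnv_smul, mul_smul, RingHom.id_apply] }, fun y => ?_⟩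
  change g (toEnv φ y • s (h (gen φ))) = h y
  rw [map_smul, hs, ← map_smul, toEnv_smul_gen]

end InnerTensor

end Inner

section Contraction

open Hochschild InnerTensor

variable {k S C : Type u} [CommRing k] [Ring S] [Algebra k S] [Ring C] [Algebra k C]
  (φ : C →ₙₐ[k] S)

variable (k S) in
/-- The algebra `S` as a module over `S ⊗ Sᵒᵖ`. -/
abbrev envModule : Module (S ⊗[k] Sᵐᵒᵖ) S := bimoduleLeft k S S S

attribute [local instance] envModule

theorem envModule_isScalarTower : IsScalarTower k (S ⊗[k] Sᵐᵒᵖ) S :=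
  bimoduleLeft_isScalarTower k S S S

attribute [local instance] envModule_isScalarTower

theorem env_smul (s t x : S) : (s ⊗ₜ[k] op t : S ⊗[k] Sᵐᵒᵖ) • x = s * (x * t) := rfl

namespace InnerTensor

/-- The multiplication `u ⊗ v ↦ u v`. -/
def mulMap : InnerTensor φ →ₗ[S ⊗[k] Sᵐᵒᵖ] S where
  toFun y := toEnv φ y • (1 : S)
  map_add' x y := by rw [map_add, add_smul]
  map_smul' r y := by rw [toEnv_smul, mul_smul, RingHom.id_apply]

theorem mulMap_tmul (u : ColumnCorner φ) (v : RowCorner φ) :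
    mulMap φ (tmul φ u v) = Corner.val S _ φ u * Corner.val S φ _ v := by
  change toEnv φ (tmul φ u v) • (1 : S) = _
  rw [toEnv_tmul, env_smul, one_mul]

theorem mulMap_balanced (c : C) (y : InnerTensor φ) : mulMap φ (op c • y) = mulMap φ (c • y) := by
  induction y using InnerTensor.induction_on with
  | h0 => simp only [smul_zero]
  | ht u v =>
    rw [InnerTensor.smul_left, InnerTensor.smul_right, mulMap_tmul, mulMap_tmul,
      Corner.val_smul_left, Corner.val_smul_right, op_smul_eq_mul, smul_eq_mul, unop_op, mul_assoc]
  | ha x y hx hy => simp only [smul_add, map_add, hx, hy]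

theorem mulMap_b (z : chain k C (InnerTensor φ) 1) :
    mulMap φ (b k C (InnerTensor φ) 0 z) = 0 := by
  refine LinearMap.congr_fun (f := (mulMap φ).restrictScalars k ∘ₗ b k C (InnerTensor φ) 0)
    (g := 0) (hom_ext fun y c => ?_) z
  change mulMap φ (op c • (show InnerTensor φ from y) +
    (-1 : k) ^ 1 • (c • (show InnerTensor φ from y))) = 0
  rw [pow_one, neg_smul, one_smul, map_add, map_neg, mulMap_balanced, add_neg_cancel]

end InnerTensor

/-- The complex `(Sφ(1) ⊗ C^{⊗n} ⊗ φ(1)S)` as a resolution of the ideal `Sφ(1)S`, given a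
contraction. -/
def cornerResolution (s₀ : S →ₗ[k] chain k C (InnerTensor φ) 0)
    (s : ∀ n, chain k C (InnerTensor φ) n →ₗ[k] chain k C (InnerTensor φ) (n + 1))
    (h0 : ∀ y, b k C (InnerTensor φ) 0 (s 0 y) + s₀ (mulMap φ y) = y)
    (hs : ∀ n z, b k C (InnerTensor φ) (n + 1) (s (n + 1) z) + s n (b k C (InnerTensor φ) n z) = z) :
    RelProjResolution k (S ⊗[k] Sᵐᵒᵖ) (LinearMap.range (mulMap φ)) :=
  letI : ∀ n, Module (S ⊗[k] Sᵐᵒᵖ) (chain k C (InnerTensor φ) n) := chainModule k C _ _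
  haveI : ∀ n, IsScalarTower k (S ⊗[k] Sᵐᵒᵖ) (chain k C (InnerTensor φ) n) :=
    chainModule_isScalarTower (k := k) (C := C) (Y := InnerTensor φ) (S ⊗[k] Sᵐᵒᵖ)
  { P := fun n => chain k C (InnerTensor φ) n
    d := fun n => { b k C (InnerTensor φ) n with
      map_smul' := fun r z => (chainMap_b _ (fun c y => smul_comm r (op c) y)
        (fun c y => smul_comm r c y) z).symm }
    ε := (mulMap φ).rangeRestrict
    d_d := fun n => b_b
    ε_d := fun z => Subtype.ext (mulMap_b φ z)
    relProjective := isRelProjective_chain _ (InnerTensor.isRelProjective φ)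
    contractible := by
      refine ⟨s₀ ∘ₗ (LinearMap.range (mulMap φ)).subtype.restrictScalars k, s, fun m => ?_, h0, hs⟩
      obtain ⟨_, y, rfl⟩ := m
      refine Subtype.ext ?_
      change mulMap φ (s₀ (mulMap φ y)) = mulMap φ y
      have h := ((mulMap φ).map_add _ _).symm.trans (congrArg (mulMap φ) (h0 y))
      rwa [mulMap_b, zero_add] at h }

section Front

variable (ρ : ColumnCorner φ →ₗ[k] C)

/-- The map `(u ⊗ v) ⊗ c₁ ⊗ ⋯ ⊗ cₙ ↦ (φ(1) ⊗ v) ⊗ ρ(u) ⊗ c₁ ⊗ ⋯ ⊗ cₙ`. -/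
def frontInsert : ∀ n, chain k C (InnerTensor φ) n →ₗ[k] chain k C (InnerTensor φ) (n + 1)
  | 0 => TensorProduct.map (TensorProduct.mk k (ColumnCorner φ) (RowCorner φ) (columnUnit φ)) ρ ∘ₗ
      (TensorProduct.comm k (ColumnCorner φ) (RowCorner φ)).toLinearMap
  | n + 1 => rTensorC k C (InnerTensor φ) (frontInsert n)

theorem frontInsert_tmul {n : ℕ} (z : chain k C (InnerTensor φ) n) (c : C) :
    frontInsert φ ρ (n + 1) (Hochschild.tmul k C (InnerTensor φ) z c) =
      Hochschild.tmul k C (InnerTensor φ) (frontInsert φ ρ n z) c := rfl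

theorem frontInsert_lact {n : ℕ} (c : C) (z : chain k C (InnerTensor φ) n) :
    frontInsert φ ρ n (lact k C (InnerTensor φ) n c z) =
      lact k C (InnerTensor φ) (n + 1) c (frontInsert φ ρ n z) := by
  induction n with
  | zero =>
    refine LinearMap.congr_fun (f := frontInsert φ ρ 0 ∘ₗ lact k C (InnerTensor φ) 0 c)
      (g := lact k C (InnerTensor φ) 1 c ∘ₗ frontInsert φ ρ 0)
      (TensorProduct.ext' fun u v => rfl) z
  | succ n ih =>
    refine LinearMap.congr_fun (f := frontInsert φ ρ (n + 1) ∘ₗ lact k C (InnerTensor φ) (n + 1) c)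
      (g := lact k C (InnerTensor φ) (n + 2) c ∘ₗ frontInsert φ ρ (n + 1))
      (hom_ext fun z d => ?_) z
    simp only [LinearMap.comp_apply, lact_tmul, frontInsert_tmul, ih]

variable (hρ : ∀ (c : C) u, ρ (op c • u) = ρ u * c)

include hρ in
theorem frontInsert_ract {n : ℕ} (c : C) (z : chain k C (InnerTensor φ) n) :
    frontInsert φ ρ n (ract k C (InnerTensor φ) n c z) =
      ract k C (InnerTensor φ) (n + 1) c (frontInsert φ ρ n z) := by
  cases n with
  | zero =>
    refine LinearMap.congr_fun (f := frontInsert φ ρ 0 ∘ₗ ract k C (InnerTensor φ) 0 c)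
      (g := ract k C (InnerTensor φ) 1 c ∘ₗ frontInsert φ ρ 0)
      (TensorProduct.ext' fun u v => ?_) z
    change Hochschild.tmul k C (InnerTensor φ) (n := 0) (InnerTensor.tmul φ (columnUnit φ) v)
      (ρ (op c • u)) = Hochschild.tmul k C (InnerTensor φ) (n := 0)
        (InnerTensor.tmul φ (columnUnit φ) v) (ρ u * c)
    rw [hρ]
  | succ n =>
    exact LinearMap.congr_fun
      (f := frontInsert φ ρ (n + 1) ∘ₗ ract k C (InnerTensor φ) (n + 1) c)
      (g := ract k C (InnerTensor φ) (n + 2) c ∘ₗ frontInsert φ ρ (n + 1))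
      (hom_ext fun z d => rfl) z

variable (hφρ : ∀ u, φ (ρ u) = Corner.val S _ φ u)

include hφρ in
theorem bPrime_frontInsert_zero (z : chain k C (InnerTensor φ) 0) :
    bPrime k C (InnerTensor φ) 0 (frontInsert φ ρ 0 z) = z := by
  refine LinearMap.congr_fun (f := bPrime k C (InnerTensor φ) 0 ∘ₗ frontInsert φ ρ 0)
      (g := LinearMap.id) (TensorProduct.ext' fun u v => ?_) z
  change InnerTensor.tmul φ (op (ρ u) • columnUnit φ) v = InnerTensor.tmul φ u v
  congr 1
  apply Corner.val_injective
  rw [Corner.val_smul_right, val_columnUnit, op_smul_eq_mul, unop_op, ← map_mul, one_mul, hφρ]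

include hρ hφρ in
theorem bPrime_frontInsert_succ {n : ℕ} (z : chain k C (InnerTensor φ) (n + 1)) :
    bPrime k C (InnerTensor φ) (n + 1) (frontInsert φ ρ (n + 1) z) +
      frontInsert φ ρ n (bPrime k C (InnerTensor φ) n z) = z := by
  induction n with
  | zero =>
    refine LinearMap.congr_fun (f := bPrime k C (InnerTensor φ) 1 ∘ₗ frontInsert φ ρ 1 +
      frontInsert φ ρ 0 ∘ₗ bPrime k C (InnerTensor φ) 0)
      (g := LinearMap.id) (hom_ext fun z c => ?_) z
    simp only [LinearMap.add_apply, LinearMap.comp_apply, frontInsert_tmul, bPrime_succ_tmul,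
      bPrime_zero_tmul, frontInsert_ract φ ρ hρ, bPrime_frontInsert_zero φ ρ hφρ,
      LinearMap.id_apply]
    simp
  | succ n ih =>
    refine LinearMap.congr_fun (f := bPrime k C (InnerTensor φ) (n + 2) ∘ₗ frontInsert φ ρ (n + 2) +
      frontInsert φ ρ (n + 1) ∘ₗ bPrime k C (InnerTensor φ) (n + 1))
      (g := LinearMap.id) (hom_ext fun z c => ?_) z
    simp only [LinearMap.add_apply, LinearMap.comp_apply, LinearMap.id_apply]
    rw [frontInsert_tmul, bPrime_succ_tmul, bPrime_succ_tmul, map_add, map_smul, frontInsert_tmul,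
      frontInsert_ract φ ρ hρ, pow_succ (-1 : k) (n + 1)]
    conv_rhs => rw [← ih z, tmul_add_left]
    simp only [mul_neg, mul_one, neg_smul]
    abel

theorem cyclicFace_frontInsert {n : ℕ} (z : chain k C (InnerTensor φ) (n + 1)) :
    cyclicFace k C (InnerTensor φ) (n + 1) (frontInsert φ ρ (n + 1) z) =
      frontInsert φ ρ n (cyclicFace k C (InnerTensor φ) n z) := by
  refine LinearMap.congr_fun
    (f := cyclicFace k C (InnerTensor φ) (n + 1) ∘ₗ frontInsert φ ρ (n + 1))
    (g := frontInsert φ ρ n ∘ₗ cyclicFace k C (InnerTensor φ) n) (hom_ext fun z c => ?_) z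
  simp only [LinearMap.comp_apply, frontInsert_tmul, cyclicFace_tmul, frontInsert_lact]

include hρ hφρ in
theorem b_frontInsert_succ {n : ℕ} (z : chain k C (InnerTensor φ) (n + 1)) :
    b k C (InnerTensor φ) (n + 1) (frontInsert φ ρ (n + 1) z) +
      frontInsert φ ρ n (b k C (InnerTensor φ) n z) = z := by
  rw [b_apply, b_apply, map_add, map_smul, cyclicFace_frontInsert, pow_succ (-1 : k) (n + 1)]
  conv_rhs => rw [← bPrime_frontInsert_succ φ ρ hρ hφρ z]
  simp only [mul_neg, mul_one, neg_smul]
  abel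

/-- The map `x ↦ φ(1) ⊗ φ(1) x`. -/
def frontUnit : S →ₗ[k] chain k C (InnerTensor φ) 0 :=
  TensorProduct.mk k (ColumnCorner φ) (RowCorner φ) (columnUnit φ) ∘ₗ
    Corner.proj S φ (NonUnitalAlgHom.id k S)

include hφρ in
theorem b_frontInsert_zero (y : chain k C (InnerTensor φ) 0) :
    b k C (InnerTensor φ) 0 (frontInsert φ ρ 0 y) + frontUnit φ (mulMap φ y) = y := by
  have h : cyclicFace k C (InnerTensor φ) 0 (frontInsert φ ρ 0 y) = frontUnit φ (mulMap φ y) := by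
    refine LinearMap.congr_fun (f := cyclicFace k C (InnerTensor φ) 0 ∘ₗ frontInsert φ ρ 0)
      (g := frontUnit φ ∘ₗ (mulMap φ).restrictScalars k) (TensorProduct.ext' fun u v => ?_) y
    change InnerTensor.tmul φ (columnUnit φ) (ρ u • v) = InnerTensor.tmul φ (columnUnit φ)
      (Corner.proj S φ (NonUnitalAlgHom.id k S) (mulMap φ (InnerTensor.tmul φ u v)))
    congr 1
    apply Corner.val_injective
    rw [Corner.val_smul_left, Corner.val_proj, mulMap_tmul, ← hφρ]
    simp [← mul_assoc, ← map_mul]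
  rw [b_apply, h, bPrime_frontInsert_zero φ ρ hφρ]
  simp

/-- The resolution of `Sφ(1)S` if `Sφ(1) = φ(C)`. -/
def frontResolution : RelProjResolution k (S ⊗[k] Sᵐᵒᵖ) (LinearMap.range (mulMap φ)) :=
  cornerResolution φ (frontUnit φ) (frontInsert φ ρ) (b_frontInsert_zero φ ρ hφρ)
    (fun _ => b_frontInsert_succ φ ρ hρ hφρ)

end Front

section Back

variable (ρ : RowCorner φ →ₗ[k] C)

variable (k C) in
/-- The map `w ⊗ c ⊗ d ↦ w ⊗ d ⊗ c`. -/
def swapLast (Y : Type u) [AddCommGroup Y] [Module k Y] (n : ℕ) :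
    chain k C Y (n + 2) →ₗ[k] chain k C Y (n + 2) :=
  (TensorProduct.rightComm k (chain k C Y n) C C).toLinearMap

variable (k C) in
/-- The map `w ⊗ d ↦ w ⊗ c d`. -/
def mulLast (Y : Type u) [AddCommGroup Y] [Module k Y] (n : ℕ) (c : C) :
    chain k C Y (n + 1) →ₗ[k] chain k C Y (n + 1) :=
  LinearMap.lTensor (chain k C Y n) (LinearMap.mulLeft k c)

section

variable {Y : Type u} [AddCommGroup Y] [Module k Y] [Module C Y] [Module Cᵐᵒᵖ Y]
  [SMulCommClass C Cᵐᵒᵖ Y] [IsScalarTower k C Y] [IsScalarTower k Cᵐᵒᵖ Y]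

local notation "tm" => Hochschild.tmul k C Y

theorem swapLast_tmul {n : ℕ} (z : chain k C Y n) (c d : C) :
    swapLast k C Y n (tm (tm z c) d) = tm (tm z d) c := rfl

theorem rTensorC_tmul {m n : ℕ} (f : chain k C Y m →ₗ[k] chain k C Y n) (z : chain k C Y m)
    (c : C) : rTensorC k C Y f (tm z c) = tm (f z) c := rfl

/-- Tensoring with a fixed last factor, as a linear map. -/
theorem ext_tmul_right {n : ℕ} {W : Type u} [AddCommGroup W] [Module k W] (d : C)
    (f : chain k C Y (n + 2) →ₗ[k] W) (g : chain k C Y (n + 1) →ₗ[k] W)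
    (h : ∀ z c, f (tm (tm z c) d) = g (tm z c)) (t : chain k C Y (n + 1)) : f (tm t d) = g t :=
  LinearMap.congr_fun (f := f ∘ₗ (TensorProduct.mk k (chain k C Y (n + 1)) C).flip d) (g := g)
    (hom_ext h) t

theorem cyclicFace_swapLast {n : ℕ} (t : chain k C Y (n + 1)) (c : C) :
    cyclicFace k C Y (n + 1) (swapLast k C Y n (tm t c)) = tm (cyclicFace k C Y n t) c :=
  ext_tmul_right c (cyclicFace k C Y (n + 1) ∘ₗ swapLast k C Y n)
    ((TensorProduct.mk k (chain k C Y n) C).flip c ∘ₗ cyclicFace k C Y n) (fun _ _ => rfl) t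

theorem mulLast_swapLast {n : ℕ} (t : chain k C Y (n + 1)) (c d : C) :
    mulLast k C Y (n + 1) c (swapLast k C Y n (tm t d)) =
      swapLast k C Y n (tm (mulLast k C Y n c t) d) :=
  ext_tmul_right d (mulLast k C Y (n + 1) c ∘ₗ swapLast k C Y n)
    (swapLast k C Y n ∘ₗ (TensorProduct.mk k (chain k C Y (n + 1)) C).flip d ∘ₗ mulLast k C Y n c)
    (fun _ _ => rfl) t

theorem rTensorC_ract_swapLast {n : ℕ} (t : chain k C Y (n + 1)) (c d : C) :
    rTensorC k C Y (ract k C Y (n + 1) c) (swapLast k C Y n (tm t d)) =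
      swapLast k C Y n (tm t (d * c)) :=
  ext_tmul_right d (rTensorC k C Y (ract k C Y (n + 1) c) ∘ₗ swapLast k C Y n)
    (swapLast k C Y n ∘ₗ (TensorProduct.mk k (chain k C Y (n + 1)) C).flip (d * c))
    (fun _ _ => rfl) t

theorem rTensorC_bPrime_swapLast_zero (t : chain k C Y 1) (c : C) :
    rTensorC k C Y (bPrime k C Y 0) (swapLast k C Y 0 (tm t c)) =
      rTensorC k C Y (ract k C Y 0 c) t :=
  ext_tmul_right c (rTensorC k C Y (bPrime k C Y 0) ∘ₗ swapLast k C Y 0)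
    (rTensorC k C Y (ract k C Y 0 c)) (fun _ _ => rfl) t

theorem rTensorC_bPrime_swapLast_succ {n : ℕ} (t : chain k C Y (n + 2)) (c : C) :
    rTensorC k C Y (bPrime k C Y (n + 1)) (swapLast k C Y (n + 1) (tm t c)) =
      swapLast k C Y n (tm (rTensorC k C Y (bPrime k C Y n) t) c) +
        (-1 : k) ^ (n + 1) • rTensorC k C Y (ract k C Y (n + 1) c) t :=
  ext_tmul_right c (rTensorC k C Y (bPrime k C Y (n + 1)) ∘ₗ swapLast k C Y (n + 1))
    (swapLast k C Y n ∘ₗ (TensorProduct.mk k (chain k C Y (n + 1)) C).flip c ∘ₗ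
      rTensorC k C Y (bPrime k C Y n) +
        (-1 : k) ^ (n + 1) • rTensorC k C Y (ract k C Y (n + 1) c)) (fun z d => by
    rw [LinearMap.comp_apply, swapLast_tmul, rTensorC_tmul, bPrime_succ_tmul, tmul_add_left,
      tmul_smul_left]
    rfl) t

theorem bPrime_swapLast {n : ℕ} (t : chain k C Y (n + 1)) (c : C) :
    bPrime k C Y (n + 1) (swapLast k C Y n (tm t c)) =
      rTensorC k C Y (bPrime k C Y n) (swapLast k C Y n (tm t c)) +
        (-1 : k) ^ (n + 1) • mulLast k C Y n c t :=
  ext_tmul_right c (bPrime k C Y (n + 1) ∘ₗ swapLast k C Y n)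
    (rTensorC k C Y (bPrime k C Y n) ∘ₗ swapLast k C Y n ∘ₗ
      (TensorProduct.mk k (chain k C Y (n + 1)) C).flip c +
        (-1 : k) ^ (n + 1) • mulLast k C Y n c) (fun _ _ => rfl) t

end

/-- The map `(u ⊗ v) ⊗ c₁ ⊗ ⋯ ⊗ cₙ ↦ (u ⊗ φ(1)) ⊗ c₁ ⊗ ⋯ ⊗ cₙ ⊗ ρ(v)`. -/
def backInsert : ∀ n, chain k C (InnerTensor φ) n →ₗ[k] chain k C (InnerTensor φ) (n + 1)
  | 0 => TensorProduct.map
      ((TensorProduct.mk k (ColumnCorner φ) (RowCorner φ)).flip (rowUnit φ)) ρ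
  | n + 1 => swapLast k C (InnerTensor φ) n ∘ₗ rTensorC k C (InnerTensor φ) (backInsert n)

theorem backInsert_tmul {n : ℕ} (z : chain k C (InnerTensor φ) n) (c : C) :
    backInsert φ ρ (n + 1) (Hochschild.tmul k C (InnerTensor φ) z c) =
      swapLast k C (InnerTensor φ) n
        (Hochschild.tmul k C (InnerTensor φ) (backInsert φ ρ n z) c) := rfl

theorem backInsert_ract {n : ℕ} (c : C) (z : chain k C (InnerTensor φ) n) :
    backInsert φ ρ n (ract k C (InnerTensor φ) n c z) =
      rTensorC k C (InnerTensor φ) (ract k C (InnerTensor φ) n c) (backInsert φ ρ n z) := by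
  cases n with
  | zero =>
    exact LinearMap.congr_fun (f := backInsert φ ρ 0 ∘ₗ ract k C (InnerTensor φ) 0 c)
      (g := rTensorC k C (InnerTensor φ) (ract k C (InnerTensor φ) 0 c) ∘ₗ backInsert φ ρ 0)
      (TensorProduct.ext' fun u v => rfl) z
  | succ n =>
    refine LinearMap.congr_fun
      (f := backInsert φ ρ (n + 1) ∘ₗ ract k C (InnerTensor φ) (n + 1) c)
      (g := rTensorC k C (InnerTensor φ) (ract k C (InnerTensor φ) (n + 1) c) ∘ₗ
        backInsert φ ρ (n + 1)) (hom_ext fun z d => ?_) z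
    rw [LinearMap.comp_apply, LinearMap.comp_apply, ract_tmul, backInsert_tmul, backInsert_tmul,
      rTensorC_ract_swapLast]

theorem backInsert_bPrime {n : ℕ} (z : chain k C (InnerTensor φ) (n + 1)) :
    backInsert φ ρ n (bPrime k C (InnerTensor φ) n z) =
      rTensorC k C (InnerTensor φ) (bPrime k C (InnerTensor φ) n) (backInsert φ ρ (n + 1) z) := by
  induction n with
  | zero =>
    refine LinearMap.congr_fun (f := backInsert φ ρ 0 ∘ₗ bPrime k C (InnerTensor φ) 0)
      (g := rTensorC k C (InnerTensor φ) (bPrime k C (InnerTensor φ) 0) ∘ₗ backInsert φ ρ 1)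
      (hom_ext fun z c => ?_) z
    rw [LinearMap.comp_apply, LinearMap.comp_apply, bPrime_zero_tmul, backInsert_ract,
      backInsert_tmul, rTensorC_bPrime_swapLast_zero]
  | succ n ih =>
    refine LinearMap.congr_fun (f := backInsert φ ρ (n + 1) ∘ₗ bPrime k C (InnerTensor φ) (n + 1))
      (g := rTensorC k C (InnerTensor φ) (bPrime k C (InnerTensor φ) (n + 1)) ∘ₗ
        backInsert φ ρ (n + 2)) (hom_ext fun z c => ?_) z
    rw [LinearMap.comp_apply, LinearMap.comp_apply, bPrime_succ_tmul, map_add, map_smul,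
      backInsert_tmul, ih, backInsert_ract, backInsert_tmul, rTensorC_bPrime_swapLast_succ]

section

variable (hρ : ∀ (c : C) v, ρ (c • v) = c * ρ v)
include hρ

theorem backInsert_lact {n : ℕ} (c : C) (z : chain k C (InnerTensor φ) n) :
    backInsert φ ρ n (lact k C (InnerTensor φ) n c z) =
      mulLast k C (InnerTensor φ) n c (backInsert φ ρ n z) := by
  induction n with
  | zero =>
    refine LinearMap.congr_fun (f := backInsert φ ρ 0 ∘ₗ lact k C (InnerTensor φ) 0 c)
      (g := mulLast k C (InnerTensor φ) 0 c ∘ₗ backInsert φ ρ 0)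
      (TensorProduct.ext' fun u v => ?_) z
    change Hochschild.tmul k C (InnerTensor φ) (n := 0) (InnerTensor.tmul φ u (rowUnit φ))
      (ρ (c • v)) = Hochschild.tmul k C (InnerTensor φ) (n := 0)
        (InnerTensor.tmul φ u (rowUnit φ)) (c * ρ v)
    rw [hρ]
  | succ n ih =>
    refine LinearMap.congr_fun
      (f := backInsert φ ρ (n + 1) ∘ₗ lact k C (InnerTensor φ) (n + 1) c)
      (g := mulLast k C (InnerTensor φ) (n + 1) c ∘ₗ backInsert φ ρ (n + 1))
      (hom_ext fun z d => ?_) z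
    rw [LinearMap.comp_apply, LinearMap.comp_apply, lact_tmul, backInsert_tmul, backInsert_tmul,
      mulLast_swapLast, ih]

theorem bPrime_backInsert_succ {n : ℕ} (z : chain k C (InnerTensor φ) (n + 1)) :
    bPrime k C (InnerTensor φ) (n + 1) (backInsert φ ρ (n + 1) z) =
      backInsert φ ρ n (b k C (InnerTensor φ) n z) := by
  refine LinearMap.congr_fun (f := bPrime k C (InnerTensor φ) (n + 1) ∘ₗ backInsert φ ρ (n + 1))
    (g := backInsert φ ρ n ∘ₗ b k C (InnerTensor φ) n) (hom_ext fun z c => ?_) z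
  rw [LinearMap.comp_apply, LinearMap.comp_apply, b_apply, map_add, map_smul, backInsert_bPrime,
    cyclicFace_tmul, backInsert_lact φ ρ hρ, backInsert_tmul, bPrime_swapLast]

end

variable (hφρ : ∀ v, φ (ρ v) = Corner.val S φ _ v)

include hφρ in
theorem cyclicFace_backInsert {n : ℕ} (z : chain k C (InnerTensor φ) n) :
    cyclicFace k C (InnerTensor φ) n (backInsert φ ρ n z) = z := by
  induction n with
  | zero =>
    refine LinearMap.congr_fun (f := cyclicFace k C (InnerTensor φ) 0 ∘ₗ backInsert φ ρ 0)
      (g := LinearMap.id) (TensorProduct.ext' fun u v => ?_) z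
    change InnerTensor.tmul φ u (ρ v • rowUnit φ) = InnerTensor.tmul φ u v
    congr 1
    apply Corner.val_injective
    rw [Corner.val_smul_left, val_rowUnit, smul_eq_mul, ← map_mul, mul_one, hφρ]
  | succ n ih =>
    refine LinearMap.congr_fun
      (f := cyclicFace k C (InnerTensor φ) (n + 1) ∘ₗ backInsert φ ρ (n + 1))
      (g := LinearMap.id) (hom_ext fun z c => ?_) z
    rw [LinearMap.comp_apply, backInsert_tmul, cyclicFace_swapLast, ih, LinearMap.id_apply]

/-- The map `x ↦ x φ(1) ⊗ φ(1)`. -/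
def backUnit : S →ₗ[k] chain k C (InnerTensor φ) 0 :=
  (TensorProduct.mk k (ColumnCorner φ) (RowCorner φ)).flip (rowUnit φ) ∘ₗ
    Corner.proj S (NonUnitalAlgHom.id k S) φ

include hφρ in
theorem bPrime_backInsert_zero (y : chain k C (InnerTensor φ) 0) :
    bPrime k C (InnerTensor φ) 0 (backInsert φ ρ 0 y) = backUnit φ (mulMap φ y) := by
  refine LinearMap.congr_fun (f := bPrime k C (InnerTensor φ) 0 ∘ₗ backInsert φ ρ 0)
    (g := backUnit φ ∘ₗ (mulMap φ).restrictScalars k) (TensorProduct.ext' fun u v => ?_) y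
  change InnerTensor.tmul φ (op (ρ v) • u) (rowUnit φ) = InnerTensor.tmul φ
    (Corner.proj S (NonUnitalAlgHom.id k S) φ (mulMap φ (InnerTensor.tmul φ u v))) (rowUnit φ)
  congr 1
  apply Corner.val_injective
  rw [Corner.val_smul_right, Corner.val_proj, mulMap_tmul, ← hφρ]
  simp [mul_assoc, ← map_mul]

/-- The resolution of `Sφ(1)S` if `φ(1)S = φ(C)`. -/
def backResolution (hρ : ∀ (c : C) v, ρ (c • v) = c * ρ v) :
    RelProjResolution k (S ⊗[k] Sᵐᵒᵖ) (LinearMap.range (mulMap φ)) :=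
  cornerResolution φ (backUnit φ) (fun n => (-1 : k) ^ (n + 1) • backInsert φ ρ n)
    (fun y => by
      rw [LinearMap.smul_apply, map_smul, b_apply, bPrime_backInsert_zero φ ρ hφρ,
        cyclicFace_backInsert φ ρ hφρ]
      simp)
    (fun n z => by
      have hs : (-1 : k) ^ (n + 1) * (-1 : k) ^ (n + 1) = 1 := by
        rw [← mul_pow, neg_one_mul, neg_neg, one_pow]
      rw [LinearMap.smul_apply, LinearMap.smul_apply, map_smul, b_apply,
        bPrime_backInsert_succ φ ρ hρ, cyclicFace_backInsert φ ρ hφρ, pow_succ (-1 : k) (n + 1)]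
      simp only [smul_add, mul_neg, mul_one, neg_smul, smul_neg, neg_neg]
      rw [smul_smul, hs, one_smul]
      abel)

end Back

end Contraction

section Coefficients

open Hochschild InnerTensor

variable {k S C X : Type u} [CommRing k] [Ring S] [Algebra k S] [Ring C] [Algebra k C]
  (φ : C →ₙₐ[k] S)
  [AddCommGroup X] [Module k X] [Module S X] [Module Sᵐᵒᵖ X] [SMulCommClass S Sᵐᵒᵖ X]
  [IsScalarTower k S X] [IsScalarTower k Sᵐᵒᵖ X]

variable (k S X) in
/-- An `S`-bimodule as a right module over `S ⊗ Sᵒᵖ`. -/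
abbrev envRightModule : Module (S ⊗[k] Sᵐᵒᵖ)ᵐᵒᵖ X := bimoduleRight k S S X

attribute [local instance] envModule envModule_isScalarTower envRightModule

theorem envRightModule_isScalarTower : IsScalarTower k (S ⊗[k] Sᵐᵒᵖ)ᵐᵒᵖ X :=
  bimoduleRight_isScalarTower k S S X

attribute [local instance] envRightModule_isScalarTower

theorem env_right_smul (s t : S) (x : X) :
    (op (s ⊗ₜ[k] op t) : (S ⊗[k] Sᵐᵒᵖ)ᵐᵒᵖ) • x = op s • t • x := rfl

theorem env_right_zero_smul (x : X) : (0 : (S ⊗[k] Sᵐᵒᵖ)ᵐᵒᵖ) • x = 0 :=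
  LinearMap.congr_fun
    (map_zero (Algebra.lsmul k k X : (S ⊗[k] Sᵐᵒᵖ)ᵐᵒᵖ →ₐ[k] Module.End k X)) x

variable (X) in
/-- The map `x, u ⊗ v ↦ v x u`. -/
def sandwich : X →ₗ[k] InnerTensor φ →ₗ[k] Corner X φ φ :=
  ((Algebra.lsmul k k X : (S ⊗[k] Sᵐᵒᵖ)ᵐᵒᵖ →ₐ[k] Module.End k X).toLinearMap ∘ₗ
    (opLinearEquiv k).toLinearMap ∘ₗ toEnv φ).flip.compr₂ (Corner.proj X φ φ)

theorem val_sandwich (x : X) (y : InnerTensor φ) :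
    Corner.val X φ φ (sandwich X φ x y) = op (toEnv φ y) • x := by
  change φ 1 • op (φ 1) • op (toEnv φ y) • x = op (toEnv φ y) • x
  induction y using InnerTensor.induction_on with
  | h0 => rw [map_zero, op_zero, env_right_zero_smul, smul_zero, smul_zero]
  | ht u v =>
    have hu : Corner.val S _ φ u * φ 1 = Corner.val S _ φ u := Corner.right_one u
    have hv : φ 1 * Corner.val S φ _ v = Corner.val S φ _ v := Corner.left_one v
    rw [toEnv_tmul, env_right_smul, ← mul_smul (op (φ 1)), ← op_mul, hu, smul_comm (φ 1),
      ← mul_smul (φ 1), hv]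
  | ha x y hx hy => simp only [map_add, op_add, add_smul, smul_add, hx, hy]

theorem sandwich_smul_right (x : X) (c : C) (y : InnerTensor φ) :
    sandwich X φ x (op c • y) = op c • sandwich X φ x y := by
  apply Corner.val_injective
  rw [Corner.val_smul_right, val_sandwich, val_sandwich]
  induction y using InnerTensor.induction_on with
  | h0 => rw [smul_zero, map_zero, op_zero, env_right_zero_smul, smul_zero]
  | ht u v =>
    rw [InnerTensor.smul_right, toEnv_tmul, toEnv_tmul, env_right_smul, env_right_smul,
      Corner.val_smul_right, ← mul_smul]
    rfl
  | ha x y hx hy => simp only [smul_add, map_add, op_add, add_smul, hx, hy]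

theorem sandwich_smul_left (x : X) (c : C) (y : InnerTensor φ) :
    sandwich X φ x (c • y) = c • sandwich X φ x y := by
  apply Corner.val_injective
  rw [Corner.val_smul_left, val_sandwich, val_sandwich]
  induction y using InnerTensor.induction_on with
  | h0 => rw [smul_zero, map_zero, op_zero, env_right_zero_smul, smul_zero]
  | ht u v =>
    rw [InnerTensor.smul_left, toEnv_tmul, toEnv_tmul, env_right_smul, env_right_smul,
      Corner.val_smul_left, smul_comm (φ c), ← mul_smul, smul_eq_mul]
  | ha x y hx hy => simp only [smul_add, map_add, op_add, add_smul, hx, hy]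

theorem sandwich_smul_env (r : S ⊗[k] Sᵐᵒᵖ) (x : X) (y : InnerTensor φ) :
    sandwich X φ (op r • x) y = sandwich X φ x (r • y) := by
  apply Corner.val_injective
  rw [val_sandwich, val_sandwich, toEnv_smul, op_mul, mul_smul]

theorem sandwich_gen (x : Corner X φ φ) : sandwich X φ (Corner.val X φ φ x) (gen φ) = x := by
  apply Corner.val_injective
  rw [val_sandwich, gen, toEnv_tmul, val_columnUnit, val_rowUnit, env_right_smul,
    Corner.left_one, Corner.right_one]

attribute [local instance] chainModule chainModule_isScalarTower

variable (X) in
/-- The map `x ⊗ ((u ⊗ v) ⊗ c₁ ⊗ ⋯ ⊗ cₙ) ↦ v x u ⊗ c₁ ⊗ ⋯ ⊗ cₙ`. -/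
def balancedToChain (n : ℕ) :
    BalancedTensor k (S ⊗[k] Sᵐᵒᵖ) X (chain k C (InnerTensor φ) n) →ₗ[k]
      chain k C (Corner X φ φ) n :=
  balancedLift (chainMap k C (InnerTensor φ) (Corner X φ φ) n ∘ₗ sandwich X φ) fun x r z => by
    change chainMap k C _ _ n (sandwich X φ (op r • x)) z =
      chainMap k C _ _ n (sandwich X φ x) (chainMap k C _ _ n _ z)
    rw [← chainMap_comp]
    congr 2
    exact LinearMap.ext fun y => sandwich_smul_env φ r x y

variable (X) in
/-- The map `(x ⊗ z), c ↦ x ⊗ (z ⊗ c)`. -/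
def balancedSnoc (n : ℕ) :
    BalancedTensor k (S ⊗[k] Sᵐᵒᵖ) X (chain k C (InnerTensor φ) n) →ₗ[k] C →ₗ[k]
      BalancedTensor k (S ⊗[k] Sᵐᵒᵖ) X (chain k C (InnerTensor φ) (n + 1)) :=
  balancedLift
    (LinearMap.mk₂ k (fun x z => balancedMk k (S ⊗[k] Sᵐᵒᵖ) X (chain k C (InnerTensor φ) (n + 1)) x
        ∘ₗ TensorProduct.mk k (chain k C (InnerTensor φ) n) C z)
      (fun x x' _ => LinearMap.ext fun _ => LinearMap.congr_fun (map_add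
        (balancedMk k (S ⊗[k] Sᵐᵒᵖ) X (chain k C (InnerTensor φ) (n + 1))) x x') _)
      (fun a x _ => LinearMap.ext fun _ => LinearMap.congr_fun (map_smul
        (balancedMk k (S ⊗[k] Sᵐᵒᵖ) X (chain k C (InnerTensor φ) (n + 1))) a x) _)
      (fun x z z' => LinearMap.ext fun c =>
        (congrArg (balancedMk k (S ⊗[k] Sᵐᵒᵖ) X (chain k C (InnerTensor φ) (n + 1)) x)
          (tmul_add_left z z' c)).trans (map_add _ _ _))
      (fun a x z => LinearMap.ext fun c => map_smul
        (balancedMk k (S ⊗[k] Sᵐᵒᵖ) X (chain k C (InnerTensor φ) (n + 1)) x) a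
        (Hochschild.tmul k C (InnerTensor φ) z c)))
    fun x r z => LinearMap.ext fun c =>
      (balancedMk_smul x r (Hochschild.tmul k C (InnerTensor φ) z c)).symm

theorem balancedSnoc_mk (n : ℕ) (x : X) (z : chain k C (InnerTensor φ) n) (c : C) :
    balancedSnoc X φ n (balancedMk k (S ⊗[k] Sᵐᵒᵖ) X _ x z) c =
      balancedMk k (S ⊗[k] Sᵐᵒᵖ) X (chain k C (InnerTensor φ) (n + 1)) x
        (Hochschild.tmul k C (InnerTensor φ) z c) := rfl

variable (X) in
/-- The map `x ⊗ c₁ ⊗ ⋯ ⊗ cₙ ↦ x ⊗ ((φ(1) ⊗ φ(1)) ⊗ c₁ ⊗ ⋯ ⊗ cₙ)`. -/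
def chainToBalanced : ∀ n : ℕ, chain k C (Corner X φ φ) n →ₗ[k]
    BalancedTensor k (S ⊗[k] Sᵐᵒᵖ) X (chain k C (InnerTensor φ) n)
  | 0 => (balancedMk k (S ⊗[k] Sᵐᵒᵖ) X (chain k C (InnerTensor φ) 0)).flip (gen φ) ∘ₗ
      Corner.val X φ φ
  | n + 1 => TensorProduct.lift (balancedSnoc X φ n ∘ₗ chainToBalanced n)

theorem balancedToChain_snoc (n : ℕ)
    (t : BalancedTensor k (S ⊗[k] Sᵐᵒᵖ) X (chain k C (InnerTensor φ) n)) (c : C) :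
    balancedToChain X φ (n + 1) (balancedSnoc X φ n t c) =
      Hochschild.tmul k C (Corner X φ φ) (balancedToChain X φ n t) c :=
  LinearMap.congr_fun (f := balancedToChain X φ (n + 1) ∘ₗ (balancedSnoc X φ n).flip c)
    (g := (TensorProduct.mk k (chain k C (Corner X φ φ) n) C).flip c ∘ₗ balancedToChain X φ n)
    (balanced_hom_ext fun _ _ => rfl) t

theorem balancedToChain_chainToBalanced (n : ℕ) (z : chain k C (Corner X φ φ) n) :
    balancedToChain X φ n (chainToBalanced X φ n z) = z := by
  induction n with
  | zero => exact sandwich_gen φ z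
  | succ n ih =>
    refine LinearMap.congr_fun (f := balancedToChain X φ (n + 1) ∘ₗ chainToBalanced X φ (n + 1))
      (g := LinearMap.id) (hom_ext fun z c => ?_) z
    change balancedToChain X φ (n + 1) (balancedSnoc X φ n (chainToBalanced X φ n z) c) = _
    rw [balancedToChain_snoc, ih, LinearMap.id_apply]

theorem chainToBalanced_balancedToChain (n : ℕ)
    (t : BalancedTensor k (S ⊗[k] Sᵐᵒᵖ) X (chain k C (InnerTensor φ) n)) :
    chainToBalanced X φ n (balancedToChain X φ n t) = t := by
  refine LinearMap.congr_fun (f := chainToBalanced X φ n ∘ₗ balancedToChain X φ n)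
    (g := LinearMap.id) (balanced_hom_ext fun x z => ?_) t
  induction n with
  | zero =>
    have h := balancedMk_smul (k := k) (Q := chain k C (InnerTensor φ) 0) x (toEnv φ z) (gen φ)
    exact (congrArg (fun w => balancedMk k (S ⊗[k] Sᵐᵒᵖ) X (chain k C (InnerTensor φ) 0) w (gen φ))
      (val_sandwich φ x z)).trans (h.symm.trans
        (congrArg (balancedMk k (S ⊗[k] Sᵐᵒᵖ) X (chain k C (InnerTensor φ) 0) x)
          (toEnv_smul_gen φ z)))
  | succ n ih =>
    refine LinearMap.congr_fun (f := chainToBalanced X φ (n + 1) ∘ₗ balancedToChain X φ (n + 1) ∘ₗ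
      balancedMk k (S ⊗[k] Sᵐᵒᵖ) X (chain k C (InnerTensor φ) (n + 1)) x)
      (g := balancedMk k (S ⊗[k] Sᵐᵒᵖ) X (chain k C (InnerTensor φ) (n + 1)) x)
      (hom_ext fun z c => ?_) z
    change balancedSnoc X φ n (chainToBalanced X φ n (balancedToChain X φ n
      (balancedMk k (S ⊗[k] Sᵐᵒᵖ) X _ x z))) c = _
    have h := ih 0 z
    rw [LinearMap.comp_apply, LinearMap.id_apply] at h
    rw [h, balancedSnoc_mk]

variable (X) in
/-- Base change of the chains with coefficients in `Sφ(1) ⊗ φ(1)S`. -/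
def balancedChainEquiv (n : ℕ) :
    BalancedTensor k (S ⊗[k] Sᵐᵒᵖ) X (chain k C (InnerTensor φ) n) ≃ₗ[k]
      chain k C (Corner X φ φ) n :=
  LinearEquiv.ofLinearMap (balancedToChain X φ n) (chainToBalanced X φ n)
    (LinearMap.ext fun z => balancedToChain_chainToBalanced φ n z)
    (LinearMap.ext fun t => chainToBalanced_balancedToChain φ n t)

theorem hochschildComplex_d (k C X : Type u) [CommRing k] [Ring C] [Algebra k C]
    [AddCommGroup X] [Module k X] [Module C X] [Module Cᵐᵒᵖ X] [SMulCommClass C Cᵐᵒᵖ X]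
    [IsScalarTower k C X] [IsScalarTower k Cᵐᵒᵖ X] (n : ℕ) :
    (hochschildComplex k C X).d (n + 1) n = ModuleCat.ofHom (b k C X n) :=
  ChainComplex.of_d (chain k C X) (fun n => ModuleCat.ofHom (b k C X n)) n

/-- Relative Tor over `S ⊗ Sᵒᵖ` computed by the resolution `(Sφ(1) ⊗ C^{⊗n} ⊗ φ(1)S)` is the
Hochschild homology of `C` with coefficients in the corner. -/
theorem exists_relTor_cornerResolution_linearEquiv
    (s₀ : S →ₗ[k] chain k C (InnerTensor φ) 0)
    (s : ∀ n, chain k C (InnerTensor φ) n →ₗ[k] chain k C (InnerTensor φ) (n + 1))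
    (h0 : ∀ y, b k C (InnerTensor φ) 0 (s 0 y) + s₀ (mulMap φ y) = y)
    (hs : ∀ n z, b k C (InnerTensor φ) (n + 1) (s (n + 1) z) + s n (b k C (InnerTensor φ) n z) = z)
    (n : ℕ) :
    Nonempty (RelTor X (cornerResolution φ s₀ s h0 hs) n ≃ₗ[k]
      HochschildHomology k C (Corner X φ φ) n) := by
  refine exists_homology_linearEquiv_of_equiv (K := relTorComplex X (cornerResolution φ s₀ s h0 hs))
    (L := hochschildComplex k C (Corner X φ φ)) (balancedChainEquiv X φ) (fun n t => ?_) n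
  rw [relTorComplex_d, hochschildComplex_d]
  refine LinearMap.congr_fun (f := b k C (Corner X φ φ) n ∘ₗ balancedToChain X φ (n + 1))
    (g := balancedToChain X φ n ∘ₗ balancedMap k X ((cornerResolution φ s₀ s h0 hs).d n))
    (balanced_hom_ext fun x z => ?_) t
  exact (chainMap_b (sandwich X φ x) (sandwich_smul_right φ x) (sandwich_smul_left φ x) z).symm

end Coefficients

section IdentityCorner

open Hochschild

variable {k S C : Type u} [CommRing k] [Ring S] [Algebra k S] [Ring C] [Algebra k C]

/-- Isomorphic bimodules have isomorphic Hochschild chains. -/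
def chainEquiv {Y Y' : Type u}
    [AddCommGroup Y] [Module k Y] [Module C Y] [Module Cᵐᵒᵖ Y] [SMulCommClass C Cᵐᵒᵖ Y]
    [IsScalarTower k C Y] [IsScalarTower k Cᵐᵒᵖ Y]
    [AddCommGroup Y'] [Module k Y'] [Module C Y'] [Module Cᵐᵒᵖ Y'] [SMulCommClass C Cᵐᵒᵖ Y']
    [IsScalarTower k C Y'] [IsScalarTower k Cᵐᵒᵖ Y'] (e : Y ≃ₗ[k] Y') (n : ℕ) : chain k C Y n ≃ₗ[k] chain k C Y' n :=
  LinearEquiv.ofLinearMap (chainMap k C Y Y' n e.toLinearMap)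
    (chainMap k C Y' Y n e.symm.toLinearMap)
    (LinearMap.ext fun z => by
      rw [LinearMap.comp_apply, ← chainMap_comp, LinearEquiv.comp_coe, LinearEquiv.symm_trans_self,
        LinearEquiv.refl_toLinearMap, chainMap_id, LinearMap.id_apply])
    (LinearMap.ext fun z => by
      rw [LinearMap.comp_apply, ← chainMap_comp, LinearEquiv.comp_coe, LinearEquiv.self_trans_symm,
        LinearEquiv.refl_toLinearMap, chainMap_id, LinearMap.id_apply])

/-- Isomorphic bimodules have isomorphic Hochschild homology. -/
theorem exists_hochschildHomology_linearEquiv {Y Y' : Type u}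
    [AddCommGroup Y] [Module k Y] [Module C Y] [Module Cᵐᵒᵖ Y] [SMulCommClass C Cᵐᵒᵖ Y]
    [IsScalarTower k C Y] [IsScalarTower k Cᵐᵒᵖ Y]
    [AddCommGroup Y'] [Module k Y'] [Module C Y'] [Module Cᵐᵒᵖ Y'] [SMulCommClass C Cᵐᵒᵖ Y']
    [IsScalarTower k C Y'] [IsScalarTower k Cᵐᵒᵖ Y'] (e : Y ≃ₗ[k] Y')
    (hl : ∀ (c : C) y, e (c • y) = c • e y) (hr : ∀ (c : C) y, e (op c • y) = op c • e y) (n : ℕ) :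
    Nonempty (HochschildHomology k C Y n ≃ₗ[k] HochschildHomology k C Y' n) := by
  refine exists_homology_linearEquiv_of_equiv (K := hochschildComplex k C Y)
    (L := hochschildComplex k C Y') (chainEquiv e) (fun n z => ?_) n
  rw [hochschildComplex_d, hochschildComplex_d]
  exact (chainMap_b e.toLinearMap hr hl z).symm

/-- The corner of `X` cut out by `1` is `X`. -/
theorem exists_hochschildHomology_corner_id_linearEquiv {X : Type u} [AddCommGroup X] [Module k X]
    [Module S X] [Module Sᵐᵒᵖ X] [SMulCommClass S Sᵐᵒᵖ X] [IsScalarTower k S X]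
    [IsScalarTower k Sᵐᵒᵖ X] (n : ℕ) :
    Nonempty (HochschildHomology k S (Corner X (NonUnitalAlgHom.id k S) (NonUnitalAlgHom.id k S)) n
      ≃ₗ[k] HochschildHomology k S X n) := by
  have h : ∀ x : X, Corner.val X _ _ (Corner.proj X (NonUnitalAlgHom.id k S)
      (NonUnitalAlgHom.id k S) x) = x := fun x => by
    rw [Corner.val_proj]
    simp
  exact exists_hochschildHomology_linearEquiv (LinearEquiv.ofLinearMap (Corner.val X _ _)
    (Corner.proj X _ _) (LinearMap.ext h)
    (LinearMap.ext fun x => Corner.val_injective (h _))) (fun _ _ => rfl) (fun _ _ => rfl) n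

end IdentityCorner

namespace TriangularAlgebra

open InnerTensor

attribute [local instance] envModule envModule_isScalarTower

section Ideals

variable {k S C : Type u} [CommRing k] [Ring S] [Algebra k S] [Ring C] [Algebra k C]
  (φ : C →ₙₐ[k] S)

theorem map_one_mul_mem_range_mulMap (x : S) : φ 1 * x ∈ LinearMap.range (mulMap φ) :=
  ⟨InnerTensor.tmul φ (columnUnit φ) (Corner.proj S φ (NonUnitalAlgHom.id k S) x), by
    rw [mulMap_tmul, val_columnUnit, Corner.val_proj]
    simp [← mul_assoc, ← map_mul]⟩

theorem mul_map_one_mem_range_mulMap (x : S) : x * φ 1 ∈ LinearMap.range (mulMap φ) :=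
  ⟨InnerTensor.tmul φ (Corner.proj S (NonUnitalAlgHom.id k S) φ x) (rowUnit φ), by
    rw [mulMap_tmul, val_rowUnit, Corner.val_proj]
    simp [mul_assoc, ← map_mul]⟩

theorem mem_range_mulMap_id (x : S) :
    x ∈ LinearMap.range (mulMap (NonUnitalAlgHom.id k S)) := by
  simpa using map_one_mul_mem_range_mulMap (NonUnitalAlgHom.id k S) x

end Ideals

variable (k A M B : Type u) [CommRing k] [Ring A] [Algebra k A] [Ring B] [Algebra k B]
  [AddCommGroup M] [Module k M] [Module A M] [Module Bᵐᵒᵖ M] [SMulCommClass A Bᵐᵒᵖ M]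
  [IsScalarTower k A M] [IsScalarTower k Bᵐᵒᵖ M]

@[simp] theorem inclA_apply (a : A) : inclA k A M B a = ⟨a, 0, 0⟩ := rfl

@[simp] theorem inclB_apply (b : B) : inclB k A M B b = ⟨0, 0, b⟩ := rfl

/-- The projection to `A`. -/
def projA : TriangularAlgebra A M B →ₐ[k] A where
  toFun x := x.a
  map_one' := rfl
  map_mul' _ _ := rfl
  map_zero' := rfl
  map_add' _ _ := rfl
  commutes' c := by
    rw [Algebra.algebraMap_eq_smul_one, Algebra.algebraMap_eq_smul_one]
    rfl

theorem projA_apply (x : TriangularAlgebra A M B) : projA k A M B x = x.a := rfl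

/-- The projection to `B`. -/
def projB : TriangularAlgebra A M B →ₐ[k] B where
  toFun x := x.b
  map_one' := rfl
  map_mul' _ _ := rfl
  map_zero' := rfl
  map_add' _ _ := rfl
  commutes' c := by
    rw [Algebra.algebraMap_eq_smul_one, Algebra.algebraMap_eq_smul_one]
    rfl

theorem projB_apply (x : TriangularAlgebra A M B) : projB k A M B x = x.b := rfl

/-- The projection `E ⊗ Eᵒᵖ → A ⊗ Bᵒᵖ`. -/
def projEnv : TriangularAlgebra A M B ⊗[k] (TriangularAlgebra A M B)ᵐᵒᵖ →ₐ[k] A ⊗[k] Bᵐᵒᵖ :=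
  Algebra.TensorProduct.map (projA k A M B) (AlgHom.op (projB k A M B))

theorem projEnv_tmul (x y : TriangularAlgebra A M B) :
    projEnv k A M B (x ⊗ₜ op y) = x.a ⊗ₜ op y.b := rfl

/-- The inclusion `A ⊗ Bᵒᵖ → E ⊗ Eᵒᵖ`. -/
def inclEnv : A ⊗[k] Bᵐᵒᵖ →ₗ[k] TriangularAlgebra A M B ⊗[k] (TriangularAlgebra A M B)ᵐᵒᵖ :=
  TensorProduct.map (inclA k A M B : A →ₗ[k] TriangularAlgebra A M B)
    ((opLinearEquiv k).toLinearMap ∘ₗ (inclB k A M B : B →ₗ[k] TriangularAlgebra A M B) ∘ₗ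
      (opLinearEquiv k).symm.toLinearMap)

theorem inclEnv_tmul (a : A) (b : B) :
    inclEnv k A M B (a ⊗ₜ op b) = inclA k A M B a ⊗ₜ op (inclB k A M B b) := rfl

theorem inclEnv_mul (x y : A ⊗[k] Bᵐᵒᵖ) :
    inclEnv k A M B (x * y) = inclEnv k A M B x * inclEnv k A M B y := by
  induction x with
  | zero => simp only [zero_mul, map_zero]
  | add x x' hx hx' => simp only [add_mul, map_add, hx, hx']
  | tmul a b =>
    induction y with
    | zero => simp only [mul_zero, map_zero]
    | add y y' hy hy' => simp only [mul_add, map_add, hy, hy']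
    | tmul a' b' =>
      induction b using MulOpposite.rec' with | _ b =>
      induction b' using MulOpposite.rec' with | _ b' =>
      rw [Algebra.TensorProduct.tmul_mul_tmul, ← op_mul, inclEnv_tmul, inclEnv_tmul, inclEnv_tmul,
        Algebra.TensorProduct.tmul_mul_tmul, ← op_mul, ← map_mul, ← map_mul]

theorem projEnv_inclEnv (x : A ⊗[k] Bᵐᵒᵖ) : projEnv k A M B (inclEnv k A M B x) = x := by
  induction x with
  | zero => simp only [map_zero]
  | add x x' hx hx' => simp only [map_add, hx, hx']
  | tmul a b => rfl

theorem mul_inclEnv_one (r : TriangularAlgebra A M B ⊗[k] (TriangularAlgebra A M B)ᵐᵒᵖ) :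
    r * inclEnv k A M B 1 = inclEnv k A M B (projEnv k A M B r) := by
  induction r with
  | zero => simp only [zero_mul, map_zero]
  | add x x' hx hx' => simp only [add_mul, map_add, hx, hx']
  | tmul x y =>
    induction y using MulOpposite.rec' with | _ y =>
    rw [Algebra.TensorProduct.one_def, ← op_one, inclEnv_tmul, projEnv_tmul, inclEnv_tmul,
      Algebra.TensorProduct.tmul_mul_tmul, ← op_mul]
    congr 2
    · ext <;> simp
    · ext <;> simp

/-- `M` as a module over `E ⊗ Eᵒᵖ`. -/
abbrev moduleEnv : Module (TriangularAlgebra A M B ⊗[k] (TriangularAlgebra A M B)ᵐᵒᵖ) M :=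
  letI := bimoduleLeft k A B M
  Module.compHom M (projEnv k A M B).toRingHom

attribute [local instance] moduleEnv

theorem moduleEnv_isScalarTower :
    IsScalarTower k (TriangularAlgebra A M B ⊗[k] (TriangularAlgebra A M B)ᵐᵒᵖ) M :=
  letI := bimoduleLeft k A B M
  haveI := bimoduleLeft_isScalarTower k A B M
  ⟨fun c r m => by
    change projEnv k A M B (c • r) • m = c • projEnv k A M B r • m
    rw [map_smul, smul_assoc]⟩

attribute [local instance] moduleEnv_isScalarTower

/-- The inclusion of the ideal `M`. -/
def inclM : M →ₗ[TriangularAlgebra A M B ⊗[k] (TriangularAlgebra A M B)ᵐᵒᵖ]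
    TriangularAlgebra A M B where
  toFun m := ⟨0, m, 0⟩
  map_add' m m' := by ext <;> simp
  map_smul' r m := by
    rw [RingHom.id_apply]
    induction r with
    | zero =>
      have h : (0 : TriangularAlgebra A M B ⊗[k] (TriangularAlgebra A M B)ᵐᵒᵖ) • m = 0 :=
        LinearMap.congr_fun (map_zero (Algebra.lsmul k k M :
          TriangularAlgebra A M B ⊗[k] (TriangularAlgebra A M B)ᵐᵒᵖ →ₐ[k] Module.End k M)) m
      have h' : (0 : TriangularAlgebra A M B ⊗[k] (TriangularAlgebra A M B)ᵐᵒᵖ) •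
          (⟨0, m, 0⟩ : TriangularAlgebra A M B) = 0 :=
        LinearMap.congr_fun (map_zero (Algebra.lsmul k k (TriangularAlgebra A M B) :
          TriangularAlgebra A M B ⊗[k] (TriangularAlgebra A M B)ᵐᵒᵖ →ₐ[k]
            Module.End k (TriangularAlgebra A M B))) _
      rw [h, h']
      rfl
    | add r r' hr hr' =>
      rw [add_smul, add_smul, ← hr, ← hr']
      ext <;> simp
    | tmul x y =>
      induction y using MulOpposite.rec' with | _ y =>
      change (⟨0, x.a • op y.b • m, 0⟩ : TriangularAlgebra A M B) = x * (⟨0, m, 0⟩ * y)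
      ext <;> simp

theorem mulMap_inclA_b (y : InnerTensor (inclA k A M B)) : (mulMap (inclA k A M B) y).b = 0 := by
  induction y using InnerTensor.induction_on with
  | h0 => rw [map_zero, zero_b]
  | ht u v =>
    have h : Corner.val _ _ (inclA k A M B) u * inclA k A M B 1 =
      Corner.val _ _ (inclA k A M B) u := Corner.right_one u
    rw [mulMap_tmul, ← h]
    simp
  | ha x y hx hy => rw [map_add, add_b, hx, hy, add_zero]

theorem mulMap_inclB_a (y : InnerTensor (inclB k A M B)) : (mulMap (inclB k A M B) y).a = 0 := by
  induction y using InnerTensor.induction_on with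
  | h0 => rw [map_zero, zero_a]
  | ht u v =>
    have h : Corner.val _ _ (inclB k A M B) u * inclB k A M B 1 =
      Corner.val _ _ (inclB k A M B) u := Corner.right_one u
    rw [mulMap_tmul, ← h]
    simp
  | ha x y hx hy => rw [map_add, add_a, hx, hy, add_zero]

theorem mem_range_mulMap_inclA (a : A) (m : M) :
    (⟨a, m, 0⟩ : TriangularAlgebra A M B) ∈ LinearMap.range (mulMap (inclA k A M B)) := by
  have h := map_one_mul_mem_range_mulMap (inclA k A M B) ⟨a, m, 0⟩
  rwa [show inclA k A M B 1 * ⟨a, m, 0⟩ = ⟨a, m, 0⟩ by ext <;> simp] at h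

theorem mem_range_mulMap_inclB (m : M) (b : B) :
    (⟨0, m, b⟩ : TriangularAlgebra A M B) ∈ LinearMap.range (mulMap (inclB k A M B)) := by
  have h := mul_map_one_mem_range_mulMap (inclB k A M B) ⟨0, m, b⟩
  rwa [show ⟨0, m, b⟩ * inclB k A M B 1 = ⟨0, m, b⟩ by ext <;> simp] at h

/-- The resolution of the ideal `E 1_A E`. -/
def resolutionA : RelProjResolution k
    (TriangularAlgebra A M B ⊗[k] (TriangularAlgebra A M B)ᵐᵒᵖ)
    (LinearMap.range (mulMap (inclA k A M B))) :=
  frontResolution (inclA k A M B) ((projA k A M B).toLinearMap ∘ₗ Corner.val _ _ _)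
    (fun c u => by
      rw [LinearMap.comp_apply, Corner.val_smul_right]
      rfl)
    (fun u => by
      rw [← Corner.right_one u]
      change (⟨_, 0, 0⟩ : TriangularAlgebra A M B) = _ * _
      ext <;> simp [projA_apply])

/-- The resolution of the ideal `E 1_B E`. -/
def resolutionB : RelProjResolution k
    (TriangularAlgebra A M B ⊗[k] (TriangularAlgebra A M B)ᵐᵒᵖ)
    (LinearMap.range (mulMap (inclB k A M B))) :=
  backResolution (inclB k A M B) ((projB k A M B).toLinearMap ∘ₗ Corner.val _ _ _)
    (fun v => by
      rw [← Corner.left_one v]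
      change (⟨0, 0, _⟩ : TriangularAlgebra A M B) = _ * _
      ext <;> simp [projB_apply])
    (fun c v => by
      rw [LinearMap.comp_apply, Corner.val_smul_left]
      rfl)

/-- The bar resolution of `S`. -/
def idResolution (k S : Type u) [CommRing k] [Ring S] [Algebra k S] :
    RelProjResolution k (S ⊗[k] Sᵐᵒᵖ) (LinearMap.range (mulMap (NonUnitalAlgHom.id k S))) :=
  frontResolution (NonUnitalAlgHom.id k S) (Corner.val _ _ _) (fun _ _ => rfl) (fun _ => rfl)

end TriangularAlgebra

namespace TriangularAlgebra

open InnerTensor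

attribute [local instance] envModule envModule_isScalarTower moduleEnv moduleEnv_isScalarTower
  envRightModule envRightModule_isScalarTower

section Sequence

variable (k A M B : Type u) [CommRing k] [Ring A] [Algebra k A] [Ring B] [Algebra k B]
  [AddCommGroup M] [Module k M] [Module A M] [Module Bᵐᵒᵖ M] [SMulCommClass A Bᵐᵒᵖ M]
  [IsScalarTower k A M] [IsScalarTower k Bᵐᵒᵖ M]

/-- The map `m ↦ (m, -m)` from `M` to `E 1_A E ⊕ E 1_B E`. -/
def antidiagonal : M →ₗ[TriangularAlgebra A M B ⊗[k] (TriangularAlgebra A M B)ᵐᵒᵖ]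
    LinearMap.range (mulMap (inclA k A M B)) × LinearMap.range (mulMap (inclB k A M B)) :=
  ((inclM k A M B).codRestrict _ fun m => mem_range_mulMap_inclA k A M B 0 m).prod
    { toFun := fun m => ⟨inclM k A M B (-m), mem_range_mulMap_inclB k A M B (-m) 0⟩
      map_add' := fun m m' => Subtype.ext
        ((congrArg (inclM k A M B) (neg_add m m')).trans (map_add (inclM k A M B) (-m) (-m')))
      map_smul' := fun r m => Subtype.ext
        ((congrArg (inclM k A M B) (smul_neg r m).symm).trans (map_smul (inclM k A M B) r (-m))) }

/-- The sum map from `E 1_A E ⊕ E 1_B E` to `E`. -/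
def sumMap : LinearMap.range (mulMap (inclA k A M B)) × LinearMap.range (mulMap (inclB k A M B))
    →ₗ[TriangularAlgebra A M B ⊗[k] (TriangularAlgebra A M B)ᵐᵒᵖ]
    LinearMap.range (mulMap (NonUnitalAlgHom.id k (TriangularAlgebra A M B))) :=
  (Submodule.inclusion fun x _ => mem_range_mulMap_id x).coprod
    (Submodule.inclusion fun x _ => mem_range_mulMap_id x)

/-- The linear retraction of `antidiagonal`. -/
def antidiagonalRetraction :
    LinearMap.range (mulMap (inclA k A M B)) × LinearMap.range (mulMap (inclB k A M B)) →ₗ[k] M where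
  toFun z := -z.2.1.m
  map_add' _ _ := neg_add _ _
  map_smul' c _ := (smul_neg c _).symm

/-- The linear section of `sumMap`. -/
def sumSection : LinearMap.range (mulMap (NonUnitalAlgHom.id k (TriangularAlgebra A M B))) →ₗ[k]
    LinearMap.range (mulMap (inclA k A M B)) × LinearMap.range (mulMap (inclB k A M B)) where
  toFun z := (⟨⟨z.1.a, z.1.m, 0⟩, mem_range_mulMap_inclA k A M B _ _⟩,
    ⟨⟨0, 0, z.1.b⟩, mem_range_mulMap_inclB k A M B _ _⟩)
  map_add' _ _ := Prod.ext
    (Subtype.ext (TriangularAlgebra.ext rfl rfl (add_zero (0 : B)).symm))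
    (Subtype.ext (TriangularAlgebra.ext (add_zero (0 : A)).symm (add_zero (0 : M)).symm rfl))
  map_smul' c _ := Prod.ext
    (Subtype.ext (TriangularAlgebra.ext rfl rfl (smul_zero c).symm))
    (Subtype.ext (TriangularAlgebra.ext (smul_zero c).symm (smul_zero c).symm rfl))

theorem sumMap_antidiagonal (m : M) : sumMap k A M B (antidiagonal k A M B m) = 0 :=
  Subtype.ext (TriangularAlgebra.ext (add_zero (0 : A)) (add_neg_cancel m) (add_zero (0 : B)))

theorem antidiagonalRetraction_antidiagonal (m : M) :
    antidiagonalRetraction k A M B (antidiagonal k A M B m) = m :=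
  neg_neg m

theorem sumMap_sumSection (z : LinearMap.range
    (mulMap (NonUnitalAlgHom.id k (TriangularAlgebra A M B)))) :
    sumMap k A M B (sumSection k A M B z) = z :=
  Subtype.ext (TriangularAlgebra.ext (add_zero z.1.a) (add_zero z.1.m) (zero_add z.1.b))

theorem antidiagonal_antidiagonalRetraction
    (y : LinearMap.range (mulMap (inclA k A M B)) × LinearMap.range (mulMap (inclB k A M B)))
    (hy : sumMap k A M B y = 0) :
    antidiagonal k A M B (antidiagonalRetraction k A M B y) = y := by
  obtain ⟨⟨z, hz⟩, ⟨w, hw⟩⟩ := y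
  have h : z + w = 0 := congrArg Subtype.val hy
  have hzb : z.b = 0 := by
    obtain ⟨t, rfl⟩ := hz
    exact mulMap_inclA_b k A M B t
  have hwa : w.a = 0 := by
    obtain ⟨t, rfl⟩ := hw
    exact mulMap_inclB_a k A M B t
  have ha : z.a = 0 := by
    have := congrArg TriangularAlgebra.a h
    rwa [add_a, hwa, add_zero] at this
  have hb : w.b = 0 := by
    have := congrArg TriangularAlgebra.b h
    rwa [add_b, hzb, zero_add] at this
  have hm : -w.m = z.m := (eq_neg_of_add_eq_zero_left (congrArg TriangularAlgebra.m h)).symm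
  exact Prod.ext (Subtype.ext (TriangularAlgebra.ext ha.symm hm hzb.symm))
    (Subtype.ext (TriangularAlgebra.ext hwa.symm (neg_neg w.m) hb.symm))

end Sequence

section Coefficients

variable {k A M B X : Type u} [CommRing k] [Ring A] [Algebra k A] [Ring B] [Algebra k B]
  [AddCommGroup M] [Module k M] [Module A M] [Module Bᵐᵒᵖ M] [SMulCommClass A Bᵐᵒᵖ M]
  [IsScalarTower k A M] [IsScalarTower k Bᵐᵒᵖ M]
  [AddCommGroup X] [Module k X] [Module (TriangularAlgebra A M B) X]
  [Module (TriangularAlgebra A M B)ᵐᵒᵖ X]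
  [SMulCommClass (TriangularAlgebra A M B) (TriangularAlgebra A M B)ᵐᵒᵖ X]
  [IsScalarTower k (TriangularAlgebra A M B) X]
  [IsScalarTower k (TriangularAlgebra A M B)ᵐᵒᵖ X]

theorem val_proj_cornerBA (x : X) :
    Corner.val X (inclB k A M B) (inclA k A M B) (Corner.proj X _ _ x) =
      op (inclEnv k A M B 1) • x := by
  rw [Corner.val_proj, Algebra.TensorProduct.one_def, ← op_one, inclEnv_tmul, env_right_smul,
    smul_comm]

theorem val_smul_cornerBA (r : A ⊗[k] Bᵐᵒᵖ) (x : CornerBA k A B M X) :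
    letI := bimoduleRight k A B (CornerBA k A B M X)
    Corner.val X (inclB k A M B) (inclA k A M B) (op r • x) =
      op (inclEnv k A M B r) • Corner.val X (inclB k A M B) (inclA k A M B) x := by
  let _ := bimoduleRight k A B (CornerBA k A B M X)
  have _ := bimoduleRight_isScalarTower k A B (CornerBA k A B M X)
  induction r with
  | zero =>
    have h : (0 : (A ⊗[k] Bᵐᵒᵖ)ᵐᵒᵖ) • x = 0 := LinearMap.congr_fun
      (map_zero (Algebra.lsmul k k (CornerBA k A B M X) :
        (A ⊗[k] Bᵐᵒᵖ)ᵐᵒᵖ →ₐ[k] Module.End k (CornerBA k A B M X))) x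
    rw [map_zero, op_zero, op_zero, env_right_zero_smul, h, map_zero]
  | add r r' hr hr' => rw [op_add, add_smul, map_add, hr, hr', map_add, op_add, add_smul]
  | tmul a b =>
    induction b using MulOpposite.rec' with | _ b =>
    rw [inclEnv_tmul, env_right_smul, bimoduleRight_smul]
    rfl

/-- Relative Tor of the bimodule `M` can be computed over `E ⊗ Eᵒᵖ`. -/
theorem exists_resolution_relTor_linearEquiv (P : BimoduleResolution k A B M) :
    ∃ Q : RelProjResolution k (TriangularAlgebra A M B ⊗[k] (TriangularAlgebra A M B)ᵐᵒᵖ) M,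
      ∀ n, Nonempty (RelTor X Q n ≃ₗ[k] BimoduleTor (CornerBA k A B M X) P n) := by
  let _ := bimoduleLeft k A B M
  have _ := bimoduleLeft_isScalarTower k A B M
  let _ := bimoduleRight k A B (CornerBA k A B M X)
  have _ := bimoduleRight_isScalarTower k A B (CornerBA k A B M X)
  exact ⟨RelProjResolution.restrict (projEnv k A M B) (inclEnv k A M B) (inclEnv_mul k A M B)
      (projEnv_inclEnv k A M B) (mul_inclEnv_one k A M B) (fun _ _ => rfl) P,
    fun n => exists_relTor_restrict_linearEquiv (projEnv k A M B) (inclEnv k A M B)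
      (inclEnv_mul k A M B) (projEnv_inclEnv k A M B) (mul_inclEnv_one k A M B)
      (Corner.val X (inclB k A M B) (inclA k A M B)) Corner.val_injective (Corner.proj X _ _)
      val_proj_cornerBA val_smul_cornerBA (fun _ _ => rfl) P n⟩

theorem exists_relTor_resolutionA_linearEquiv (n : ℕ) :
    Nonempty (RelTor X (resolutionA k A M B) n ≃ₗ[k]
      HochschildHomology k A (CornerAA k A B M X) n) := by
  rw [resolutionA, frontResolution]
  exact exists_relTor_cornerResolution_linearEquiv _ _ _ _ _ n

theorem exists_relTor_resolutionB_linearEquiv (n : ℕ) :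
    Nonempty (RelTor X (resolutionB k A M B) n ≃ₗ[k]
      HochschildHomology k B (CornerBB k A B M X) n) := by
  rw [resolutionB, backResolution]
  exact exists_relTor_cornerResolution_linearEquiv _ _ _ _ _ n

end Coefficients

theorem exists_relTor_idResolution_linearEquiv {k S X : Type u} [CommRing k] [Ring S] [Algebra k S]
    [AddCommGroup X] [Module k X] [Module S X] [Module Sᵐᵒᵖ X] [SMulCommClass S Sᵐᵒᵖ X]
    [IsScalarTower k S X] [IsScalarTower k Sᵐᵒᵖ X] (n : ℕ) :
    Nonempty (RelTor X (idResolution k S) n ≃ₗ[k] HochschildHomology k S X n) := by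
  rw [idResolution]
  delta frontResolution
  exact ⟨(exists_relTor_cornerResolution_linearEquiv _ _ _ _ _ n).some.trans
    (exists_hochschildHomology_corner_id_linearEquiv n).some⟩

end TriangularAlgebra

end

open TriangularAlgebra in
attribute [local instance] envModule envModule_isScalarTower moduleEnv moduleEnv_isScalarTower
  envRightModule envRightModule_isScalarTower in
theorem theorem1 {k A B M X : Type u} [CommRing k] [Ring A] [Algebra k A] [Ring B] [Algebra k B]
    [AddCommGroup M] [Module k M] [Module A M] [Module Bᵐᵒᵖ M] [SMulCommClass A Bᵐᵒᵖ M]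
    [IsScalarTower k A M] [IsScalarTower k Bᵐᵒᵖ M]
    [AddCommGroup X] [Module k X] [Module (TriangularAlgebra A M B) X]
    [Module (TriangularAlgebra A M B)ᵐᵒᵖ X]
    [SMulCommClass (TriangularAlgebra A M B) (TriangularAlgebra A M B)ᵐᵒᵖ X]
    [IsScalarTower k (TriangularAlgebra A M B) X]
    [IsScalarTower k (TriangularAlgebra A M B)ᵐᵒᵖ X]
    (P : BimoduleResolution k A B M) :
    ∃ (f : ∀ n : ℕ, BimoduleTor (TriangularAlgebra.CornerBA k A B M X) P n →ₗ[k]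
          HochschildHomology k A (TriangularAlgebra.CornerAA k A B M X) n ×
          HochschildHomology k B (TriangularAlgebra.CornerBB k A B M X) n)
      (g : ∀ n : ℕ, HochschildHomology k A (TriangularAlgebra.CornerAA k A B M X) n ×
          HochschildHomology k B (TriangularAlgebra.CornerBB k A B M X) n →ₗ[k]
          HochschildHomology k (TriangularAlgebra A M B) X n)
      (δ : ∀ n : ℕ, HochschildHomology k (TriangularAlgebra A M B) X (n + 1) →ₗ[k]
          BimoduleTor (TriangularAlgebra.CornerBA k A B M X) P n),
      (∀ n, Function.Exact (f n) (g n)) ∧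
      (∀ n, Function.Exact (g (n + 1)) (δ n)) ∧
      (∀ n, Function.Exact (δ n) (f n)) ∧
      Function.Surjective (g 0) := by
  obtain ⟨Q, hQ⟩ := exists_resolution_relTor_linearEquiv (X := X) P
  refine exists_exact_sequence_of_equiv (fun n => (hQ n).some)
    (fun n => (exists_relTor_prod_linearEquiv X (resolutionA k A M B) (resolutionB k A M B) n).some
      |>.trans (LinearEquiv.prodCongr
        (exists_relTor_resolutionA_linearEquiv n).some
        (exists_relTor_resolutionB_linearEquiv n).some))
    (fun n => (exists_relTor_idResolution_linearEquiv n).some)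
    (exists_relTor_exact_sequence X Q ((resolutionA k A M B).prod (resolutionB k A M B))
      (idResolution k (TriangularAlgebra A M B)) (antidiagonal k A M B) (sumMap k A M B)
      (antidiagonalRetraction k A M B) (sumSection k A M B) (sumMap_antidiagonal k A M B)
      (antidiagonalRetraction_antidiagonal k A M B) (sumMap_sumSection k A M B)
      (antidiagonal_antidiagonalRetraction k A M B))
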